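/- Let $G$ be a countable discrete group. A \emph{trace} on $G$ is a function $\varphi:G\to\mathbb{C}$ with $\varphi(e)=1$ and $\varphi(hgh^{-1})=\varphi(g)$ for all $g,h\in G$ which is positive definite, i.e. for all $n$ and $g_1,\dots,g_n\in G$ the matrix $(\varphi(g_i^{-1}g_j))_{i,j}$ is Hermitian positive semidefinite. A \emph{character} of $G$ is an extreme point of the convex set of traces on $G$. The group $G$ is \emph{character rigid} if every character $\varphi$ of $G$ either is of the form $\varphi=\frac{1}{\dim\pi}\,\mathrm{tr}\circ\pi$ for some finite-dimensional irreducible unitary representation $\pi$ of $G$, or satisfies $\varphi(g)=0$ for every $g$ outside the center $\mathrm{Z}(G)$. The group $G$ is \emph{ICC} if the conjugacy class of every non-trivial element of $G$ is infinite. \textbf{Proposition.} Let $\Lambda$ be a countable ICC group having, up to unitary equivalence, at most countably many finite-dimensional unitary representations. Let $\Lambda_0$ be a finite-index subgroup of $\Lambda$. Then $\Lambda$ is character rigid if and only if $\Lambda_0$ is character rigid. -/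

import Mathlib

open scoped ComplexOrder

/-- A function `φ : G → ℂ` is positive definite if for all `g₁, …, gₙ` the matrix
`(φ (gᵢ⁻¹ gⱼ))` is positive (Hermitian with nonnegative quadratic form; the `gᵢ` need not be
distinct, so this is Mathlib's `Matrix.PosSemidef`). -/
def IsPositiveDefiniteFun {G : Type*} [Group G] (φ : G → ℂ) : Prop :=
  ∀ (n : ℕ) (g : Fin n → G), (Matrix.of fun i j => φ ((g i)⁻¹ * g j)).PosSemidef

/-- The set `Tr(G)` of traces on the discrete group `G`: normalized, conjugation-invariant,
positive definite functions. -/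
def groupTraces (G : Type*) [Group G] : Set (G → ℂ) :=
  {φ | IsPositiveDefiniteFun φ ∧ φ 1 = 1 ∧ ∀ g h : G, φ (h * g * h⁻¹) = φ g}

/-- The set `Ch(G)` of characters of `G`: the extreme points of the convex set of traces. -/
def groupCharacters (G : Type*) [Group G] : Set (G → ℂ) :=
  Set.extremePoints ℝ (groupTraces G)

/-- A unitary representation of `G` of dimension `n`, up to the choice of an orthonormal basis:
a homomorphism `G → U(n)`. -/
abbrev FinDimUnitaryRep (G : Type*) [Group G] (n : ℕ) : Type _ :=
  G →* Matrix.unitaryGroup (Fin n) ℂ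

/-- The linear representation of `G` on `ℂⁿ` underlying a homomorphism `G → U(n)`. -/
noncomputable def FinDimUnitaryRep.toRepresentation {G : Type*} [Group G] {n : ℕ}
    (π : FinDimUnitaryRep G n) : Representation ℂ G (Fin n → ℂ) where
  toFun g := Matrix.toLin' (π g : Matrix (Fin n) (Fin n) ℂ)
  map_one' := by simp [Module.End.one_eq_id]
  map_mul' g h := by simp [Matrix.toLin'_mul, Module.End.mul_eq_comp]

/-- Unitary equivalence of `n`-dimensional unitary representations. -/
def unitaryEquivalence (G : Type*) [Group G] (n : ℕ) : Setoid (FinDimUnitaryRep G n) where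
  r π ρ := ∃ u : Matrix.unitaryGroup (Fin n) ℂ, ∀ g, ρ g = u * π g * u⁻¹
  iseqv :=
    { refl := fun π => ⟨1, fun g => by simp⟩
      symm := fun {π ρ} ⟨u, hu⟩ => ⟨u⁻¹, fun g => by rw [hu g]; group⟩
      trans := fun {π ρ σ} ⟨u, hu⟩ ⟨v, hv⟩ =>
        ⟨v * u, fun g => by rw [hv g, hu g]; group⟩ }

/-- `G` has at most countably many finite-dimensional unitary representations, up to unitary
equivalence. -/
def HasCountablyManyFinDimUnitaryReps (G : Type*) [Group G] : Prop :=
  Countable (Σ n : ℕ, Quotient (unitaryEquivalence G n))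

/-- `φ` is of the form `(1 / dim π) tr ∘ π` for a finite-dimensional irreducible unitary
representation `π`. (Irreducible representations are nonzero, so `n ≠ 0`.) -/
def IsFinDimCharacter {G : Type*} [Group G] (φ : G → ℂ) : Prop :=
  ∃ (n : ℕ) (π : FinDimUnitaryRep G n), π.toRepresentation.IsIrreducible ∧
    ∀ g, φ g = (1 / (n : ℂ)) * Matrix.trace (π g : Matrix (Fin n) (Fin n) ℂ)

/-- `G` is character rigid if every character of `G` is finite-dimensional or vanishes outside
the center of `G`. -/
def IsCharacterRigid (G : Type*) [Group G] : Prop :=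
  ∀ φ ∈ groupCharacters G, IsFinDimCharacter φ ∨ ∀ g ∉ Subgroup.center G, φ g = 0

/-- `G` is ICC if every nontrivial element has an infinite conjugacy class. -/
def IsICC (G : Type*) [Group G] : Prop :=
  ∀ g : G, g ≠ 1 → (conjugatesOf g).Infinite

/-!
Since the groups `Λ` and `Λ₀` are ICC and share the normal core `N` of `Λ₀`, which is ICC as well, it
suffices to compare an ICC group `G` with a normal subgroup `N` of finite index
(`isCharacterRigid_iff_of_normal`). For ICC groups, rigidity says that every character is
finite-dimensional or equal to the regular trace `δ₁`.

The bridge between the two groups is the convex set of `G`-invariant traces on `N`.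

* If `φ` is a character of `G`, then its restriction to `N` is extreme among the `G`-invariant traces
  (`restrictTo_mem_extremePoints`).
* If `φ` is a character of `N`, then the average of its `G`-conjugates is extreme among the
  `G`-invariant traces (`conjAverage_mem_extremePoints`).

Restriction and averaging are continuous and affine, so the fibres of these extreme points are
compact faces of the sets of traces, and the Krein–Milman theorem produces characters in them
(`exists_mem_groupCharacters_map_eq`). Hence for each character `φ` of one of the groups there is a
character of the other one such that restriction and averaging send the two to the same invariant
trace. If that character is `δ₁`, then `φ` is `δ₁` by a Bessel inequality on an infinite conjugacy
class. If it is finite-dimensional, then the GNS space of `φ` is finite-dimensional, because finite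
rank passes to averages, to dominated functions, and from `N` to `G`; and a character with
finite-dimensional GNS space is the normalized trace of an irreducible representation
(`isFinDimCharacter_of_hasFiniteRank`).

The two extremality statements rest on the fact that the commutant of the left and right translations
on the GNS space of a trace is commutative (`IsGNS.operator_comm`). A positive definite class function
dominated by the trace is represented by a positive operator in this commutant; as these operators
commute, their products are positive, which yields the Riesz decomposition property.
-/

section

open scoped InnerProductSpace ComplexConjugate

universe u

variable {G : Type*} [Group G]

/-! ### Positive definite functions and the GNS construction -/

/-- The matrix `(φ (g⁻¹ h))`, indexed by the whole group. -/
def translationMatrix (φ : G → ℂ) : Matrix G G ℂ := .of fun g h => φ (g⁻¹ * h)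

/-- The quadratic form `∑ conj (f g) φ (g⁻¹ h) (f h)` on finitely supported functions. -/
noncomputable def quadForm (φ : G → ℂ) (f : G →₀ ℂ) : ℂ :=
  f.sum fun g a => f.sum fun h b => star a * φ (g⁻¹ * h) * b

lemma isPositiveDefiniteFun_iff_posSemidef {φ : G → ℂ} :
    IsPositiveDefiniteFun φ ↔ (translationMatrix φ).PosSemidef := by
  constructor
  · intro h
    refine ⟨?_, fun f => ?_⟩
    · ext g k
      have := (h 2 ![g, k]).isHermitian.apply 0 1
      simpa [translationMatrix] using this
    · classical
      let en := f.support.equivFin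
      have key := (h f.support.card (fun i => (en.symm i : G))).dotProduct_mulVec_nonneg
        (fun i => f (en.symm i))
      convert key using 1
      simp only [Finsupp.sum, dotProduct, Matrix.mulVec, Finset.mul_sum, translationMatrix,
        Matrix.of_apply, Pi.star_apply, mul_assoc]
      rw [← Finset.sum_coe_sort, ← en.symm.sum_comp]
      refine Finset.sum_congr rfl fun i _ => ?_
      rw [← Finset.sum_coe_sort, ← en.symm.sum_comp]
  · intro h n g
    exact h.submatrix g

lemma IsPositiveDefiniteFun.quadForm_nonneg {φ : G → ℂ} (h : IsPositiveDefiniteFun φ)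
    (f : G →₀ ℂ) : 0 ≤ quadForm φ f :=
  (isPositiveDefiniteFun_iff_posSemidef.1 h).2 f

lemma IsPositiveDefiniteFun.apply_inv {φ : G → ℂ} (h : IsPositiveDefiniteFun φ) (g : G) :
    φ g⁻¹ = conj (φ g) := by
  have := (isPositiveDefiniteFun_iff_posSemidef.1 h).isHermitian.apply g 1
  simpa [translationMatrix] using this.symm

/-- Gram matrices of translation-invariant families are positive definite functions. -/
lemma isPositiveDefiniteFun_of_inner {H : Type*} [NormedAddCommGroup H] [InnerProductSpace ℂ H]
    {φ : G → ℂ} (e : G → H) (he : ∀ g h, ⟪e g, e h⟫_ℂ = φ (g⁻¹ * h)) :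
    IsPositiveDefiniteFun φ := by
  intro n g
  have hM : (Matrix.of fun i j => φ ((g i)⁻¹ * g j)) = Matrix.gram ℂ fun i => e (g i) := by
    ext i j
    simp [he]
  rw [hM]
  exact Matrix.posSemidef_gram ℂ _

lemma quadForm_sub (φ ψ : G → ℂ) (f : G →₀ ℂ) :
    quadForm (φ - ψ) f = quadForm φ f - quadForm ψ f := by
  simp [quadForm, Finsupp.sum, mul_sub, sub_mul, Finset.sum_sub_distrib]

lemma quadForm_smul (c : ℝ) (φ : G → ℂ) (f : G →₀ ℂ) :
    quadForm (c • φ) f = c * quadForm φ f := by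
  simp only [quadForm, Finsupp.sum, Finset.mul_sum, Pi.smul_apply, Complex.real_smul]
  exact Finset.sum_congr rfl fun _ _ => Finset.sum_congr rfl fun _ _ => by ring

lemma quadForm_eq_norm_sq {H : Type*} [NormedAddCommGroup H] [InnerProductSpace ℂ H]
    {φ : G → ℂ} {e : G → H} (he : ∀ g h, ⟪e g, e h⟫_ℂ = φ (g⁻¹ * h)) (f : G →₀ ℂ) :
    quadForm φ f = (‖Finsupp.linearCombination ℂ e f‖ ^ 2 : ℝ) := by
  have h := inner_self_eq_norm_sq_to_K (𝕜 := ℂ) (Finsupp.linearCombination ℂ e f)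
  rw [Complex.ofReal_pow]
  refine Eq.trans ?_ h
  rw [Finsupp.linearCombination_apply, Finsupp.sum, sum_inner]
  refine Finset.sum_congr rfl fun _ _ => ?_
  rw [inner_sum]
  refine Finset.sum_congr rfl fun _ _ => ?_
  rw [inner_smul_left, inner_smul_right, he, RCLike.star_def]
  ring

/-- The Gelfand–Naimark–Segal construction for a positive definite function. -/
theorem IsPositiveDefiniteFun.exists_gns {G : Type u} [Group G] {φ : G → ℂ}
    (h : IsPositiveDefiniteFun φ) :
    ∃ (H : Type u) (_ : NormedAddCommGroup H) (_ : InnerProductSpace ℂ H) (_ : CompleteSpace H)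
      (e : G → H), (∀ g k, ⟪e g, e k⟫_ℂ = φ (g⁻¹ * k)) ∧
        DenseRange (Finsupp.linearCombination ℂ e) := by
  let K : Matrix G G (ℂ →L[ℂ] ℂ) := .of fun g k => φ (g⁻¹ * k) • ContinuousLinearMap.id ℂ ℂ
  have hK : K.PosSemidef := by
    refine ((RKHS.posSemidef_tfae (K := K)).out 0 2 rfl rfl).2 ⟨?_, fun f => ?_⟩
    · ext g k
      have := h.apply_inv (k⁻¹ * g)
      simp_all [K, Matrix.conjTranspose_apply, ContinuousLinearMap.star_eq_adjoint,
        ContinuousLinearMap.adjoint_id]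
    · have h0 := (Complex.le_def.1 (h.quadForm_nonneg f)).1
      rw [Complex.zero_re, ← Complex.conj_re] at h0
      rw [Finsupp.sum_comm]
      convert h0 using 2
      simp only [quadForm, Finsupp.sum, map_sum, map_mul, Complex.re_sum]
      refine Finset.sum_congr rfl fun _ _ => Finset.sum_congr rfl fun _ _ => ?_
      simp [K]
      ring
  have : Fact K.PosSemidef := ⟨hK⟩
  refine ⟨RKHS.OfKernel K, inferInstance, inferInstance, inferInstance,
    fun g => RKHS.kerFun _ g 1, fun g k => ?_, ?_⟩
  · rw [← RKHS.kernel_inner, RKHS.OfKernel.kernel_ofKernel]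
    simp [K, ← h.apply_inv]
  · have hd := RKHS.kerFun_dense (𝕜 := ℂ) (V := ℂ) (X := G) (RKHS.OfKernel K)
    rw [DenseRange, ← LinearMap.coe_range]
    rw [Submodule.dense_iff_topologicalClosure_eq_top, ← top_le_iff, ← hd]
    apply Submodule.topologicalClosure_mono
    rw [Submodule.span_le]
    rintro _ ⟨x, v, rfl⟩
    refine ⟨Finsupp.single x v, ?_⟩
    simp [← map_smul]

/-! ### Bounded operators representing class functions -/

section

/-- A function on a group is a class function if it is constant on conjugacy classes. -/
def IsClassFun (φ : G → ℂ) : Prop := ∀ g h, φ (h * g * h⁻¹) = φ g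

lemma IsClassFun.mul_comm {φ : G → ℂ} (h : IsClassFun φ) (a b : G) : φ (a * b) = φ (b * a) := by
  simpa [mul_assoc] using (h (a * b) a⁻¹).symm

variable {H : Type*} [NormedAddCommGroup H] [InnerProductSpace ℂ H]

/-- The family `e : G → H` is the orbit of the cyclic vector in the GNS representation of `φ`: it
spans a dense subspace and has Gram matrix `(φ (g⁻¹ h))`. -/
structure IsGNS (φ : G → ℂ) (e : G → H) : Prop where
  inner_eq : ∀ g h, ⟪e g, e h⟫_ℂ = φ (g⁻¹ * h)
  dense : DenseRange (Finsupp.linearCombination ℂ e)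

lemma inner_linearCombination_apply {ι : Type*} (e : ι → H) (T : H →L[ℂ] H) (f : ι →₀ ℂ) :
    ⟪Finsupp.linearCombination ℂ e f, T (Finsupp.linearCombination ℂ e f)⟫_ℂ =
      f.sum fun g a => f.sum fun h b => star a * ⟪e g, T (e h)⟫_ℂ * b := by
  rw [Finsupp.linearCombination_apply, Finsupp.sum, sum_inner]
  refine Finset.sum_congr rfl fun _ _ => ?_
  rw [map_sum, inner_sum]
  refine Finset.sum_congr rfl fun _ _ => ?_
  rw [map_smul, inner_smul_left, inner_smul_right, RCLike.star_def]
  ring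

namespace IsGNS

variable {φ α β : G → ℂ} {e : G → H}

lemma norm_sq (he : IsGNS φ e) (f : G →₀ ℂ) :
    ((‖Finsupp.linearCombination ℂ e f‖ ^ 2 : ℝ) : ℂ) = quadForm φ f :=
  (quadForm_eq_norm_sq he.inner_eq f).symm

/-- A closed property of vectors that is stable under linear combinations holds everywhere if it
holds on the orbit. -/
lemma induction (he : IsGNS φ e) {p : H → Prop} (hc : IsClosed {x | p x})
    (hadd : ∀ x y, p x → p y → p (x + y)) (hsmul : ∀ (c : ℂ) x, p x → p (c • x))
    (hb : ∀ g, p (e g)) (x : H) : p x := by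
  refine he.dense.induction_on x hc fun f => ?_
  induction f using Finsupp.induction_linear with
  | zero => simpa using hsmul 0 _ (hb 1)
  | add f g hf hg => simpa using hadd _ _ hf hg
  | single g a => simpa using hsmul a _ (hb g)

lemma ext_inner (he : IsGNS φ e) {x y : H} (h : ∀ g, ⟪e g, x⟫_ℂ = ⟪e g, y⟫_ℂ) : x = y := by
  refine ext_inner_left ℂ fun v => ?_
  refine he.induction (p := fun v => ⟪v, x⟫_ℂ = ⟪v, y⟫_ℂ)
    (isClosed_eq (by fun_prop) (by fun_prop)) ?_ ?_ h v
  · intro a b ha hb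
    rw [inner_add_left, inner_add_left, ha, hb]
  · intro c a ha
    rw [inner_smul_left, inner_smul_left, ha]

lemma ext_operator (he : IsGNS φ e) {T S : H →L[ℂ] H} (h : ∀ g, T (e g) = S (e g)) : T = S := by
  ext x
  refine he.induction (p := fun x => T x = S x)
    (isClosed_eq (by fun_prop) (by fun_prop)) ?_ ?_ h x
  · intro a b ha hb
    simp [ha, hb]
  · intro c a ha
    simp [ha]

/-- An operator whose matrix coefficients form a positive definite function is positive. -/
lemma isPositive (he : IsGNS φ e) (hα : IsPositiveDefiniteFun α) {T : H →L[ℂ] H}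
    (hT : ∀ g h, ⟪e g, T (e h)⟫_ℂ = α (g⁻¹ * h)) : T.IsPositive := by
  have key : ∀ x, 0 ≤ ⟪x, T x⟫_ℂ := by
    intro x
    refine he.dense.induction_on (p := fun x => 0 ≤ ⟪x, T x⟫_ℂ) x
      (isClosed_le (by fun_prop) (by fun_prop)) fun f => ?_
    convert hα.quadForm_nonneg f using 1
    simp only [inner_linearCombination_apply, hT, quadForm]
  rw [ContinuousLinearMap.isPositive_iff_complex]
  intro x
  have h1 : 0 ≤ ⟪T x, x⟫_ℂ := by
    rw [← inner_conj_symm, ← RCLike.star_def]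
    exact star_nonneg_iff.2 (key x)
  obtain ⟨h2, h3⟩ := Complex.le_def.1 h1
  exact ⟨Complex.ext rfl h3, h2⟩

variable [CompleteSpace H]

/-- Permutations of the group that preserve the kernel `φ (g⁻¹ h)` act by isometries. -/
lemma exists_isometry (he : IsGNS φ e) (σ : Equiv.Perm G)
    (hσ : ∀ g h, φ ((σ g)⁻¹ * σ h) = φ (g⁻¹ * h)) :
    ∃ U : H →ₗᵢ[ℂ] H, ∀ g, U (e g) = e (σ g) := by
  let f := Finsupp.linearCombination ℂ (e ∘ σ)
  have hn : ∀ x, ‖f x‖ = ‖Finsupp.linearCombination ℂ e x‖ := by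
    intro x
    have h1 := quadForm_eq_norm_sq (φ := φ) (e := e ∘ σ) (fun g h => by simp [he.inner_eq, hσ]) x
    rw [← he.norm_sq] at h1
    exact ((sq_eq_sq₀ (norm_nonneg _) (norm_nonneg _)).1 (Complex.ofReal_injective h1)).symm
  have hb : ∃ C, ∀ x, ‖f x‖ ≤ C * ‖Finsupp.linearCombination ℂ e x‖ :=
    ⟨1, fun x => by rw [hn, one_mul]⟩
  let U := f.extendOfNorm (Finsupp.linearCombination ℂ e)
  have hU : ∀ x, U (Finsupp.linearCombination ℂ e x) = f x :=
    LinearMap.extendOfNorm_eq he.dense hb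
  refine ⟨⟨U.toLinearMap, fun x => ?_⟩, fun g => ?_⟩
  · refine he.dense.induction_on (p := fun x => ‖U x‖ = ‖x‖) x
      (isClosed_eq (by fun_prop) (by fun_prop)) fun y => ?_
    rw [hU, hn]
  · simpa [f] using hU (Finsupp.single g 1)

/-- For a trace, the inversion of the group induces a conjugate-linear involution. -/
lemma exists_conjugation (he : IsGNS φ e) (hφ : IsClassFun φ) :
    ∃ J : H →SL[starRingEnd ℂ] H, ∀ g, J (e g) = e g⁻¹ := by
  let f : (G →₀ ℂ) →ₛₗ[starRingEnd ℂ] H :=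
    { toFun := fun x => x.sum fun g a => conj a • e g⁻¹
      map_add' := fun x y => by
        apply Finsupp.sum_add_index' <;> simp [add_smul]
      map_smul' := fun c x => by
        rw [Finsupp.sum_smul_index (by simp)]
        simp [Finsupp.smul_sum, mul_smul] }
  have hn : ∀ x, ‖f x‖ = ‖Finsupp.linearCombination ℂ e x‖ := by
    intro x
    refine (sq_eq_sq₀ (norm_nonneg _) (norm_nonneg _)).1 (Complex.ofReal_injective ?_)
    rw [he.norm_sq, Complex.ofReal_pow]
    refine (inner_self_eq_norm_sq_to_K (𝕜 := ℂ) (f x)).symm.trans ?_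
    change ⟪x.sum fun g a => conj a • e g⁻¹, x.sum fun g a => conj a • e g⁻¹⟫_ℂ = _
    rw [Finsupp.sum, sum_inner, quadForm, Finsupp.sum_comm]
    refine Finset.sum_congr rfl fun g _ => ?_
    rw [inner_sum]
    refine Finset.sum_congr rfl fun h _ => ?_
    rw [inner_smul_left, inner_smul_right, he.inner_eq, inv_inv, hφ.mul_comm, RCLike.star_def,
      Complex.conj_conj]
    ring
  refine ⟨f.extendOfNorm (Finsupp.linearCombination ℂ e), fun g => ?_⟩
  have := LinearMap.extendOfNorm_eq (f := f) he.dense ⟨1, fun x => by rw [hn, one_mul]⟩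
    (Finsupp.single g 1)
  simpa [f] using this

/-- Radon–Nikodym: a positive definite function dominated by a multiple of `φ` is given by the
matrix coefficients of a bounded operator on the GNS space of `φ`. -/
lemma exists_operator (he : IsGNS φ e) (hα : IsPositiveDefiniteFun α) {C : ℝ}
    (hle : IsPositiveDefiniteFun (C • φ - α)) :
    ∃ T : H →L[ℂ] H, ∀ g h, ⟪e g, T (e h)⟫_ℂ = α (g⁻¹ * h) := by
  obtain ⟨K, _, _, _, k, hk, hkd⟩ := hα.exists_gns
  have hn : ∀ x, ‖Finsupp.linearCombination ℂ k x‖ ≤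
      √C * ‖Finsupp.linearCombination ℂ e x‖ := by
    intro x
    have h1 := hle.quadForm_nonneg x
    rw [quadForm_sub, quadForm_smul, quadForm_eq_norm_sq hk, ← he.norm_sq, sub_nonneg] at h1
    have h2 : ‖Finsupp.linearCombination ℂ k x‖ ^ 2 ≤
        C * ‖Finsupp.linearCombination ℂ e x‖ ^ 2 := by exact_mod_cast h1
    have h3 := Real.sqrt_le_sqrt h2
    rwa [Real.sqrt_sq (norm_nonneg _), Real.sqrt_mul' _ (sq_nonneg _),
      Real.sqrt_sq (norm_nonneg _)] at h3
  let S := (Finsupp.linearCombination ℂ k).extendOfNorm (Finsupp.linearCombination ℂ e)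
  have hS : ∀ g, S (e g) = k g := by
    intro g
    have := LinearMap.extendOfNorm_eq (f := Finsupp.linearCombination ℂ k) he.dense
      ⟨_, hn⟩ (Finsupp.single g 1)
    simpa using this
  refine ⟨S.adjoint ∘L S, fun g h => ?_⟩
  rw [ContinuousLinearMap.comp_apply, ContinuousLinearMap.adjoint_inner_right, hS, hS, hk]

omit [CompleteSpace H] in
/-- Symmetries of `φ` and `α` commute with the operator representing `α`. -/
lemma isometry_comm (he : IsGNS φ e) {T : H →L[ℂ] H}
    (hT : ∀ g h, ⟪e g, T (e h)⟫_ℂ = α (g⁻¹ * h)) (σ : Equiv.Perm G)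
    (hα : ∀ g h, α ((σ g)⁻¹ * σ h) = α (g⁻¹ * h)) {U : H →ₗᵢ[ℂ] H}
    (hU : ∀ g, U (e g) = e (σ g)) (x : H) : T (U x) = U (T x) := by
  suffices T ∘L U.toContinuousLinearMap = U.toContinuousLinearMap ∘L T from
    DFunLike.congr_fun this x
  refine he.ext_operator fun g => he.ext_inner fun h => ?_
  obtain ⟨h, rfl⟩ := σ.surjective h
  have : ⟪e (σ h), U (T (e g))⟫_ℂ = α (h⁻¹ * g) := by
    rw [← hU, U.inner_map_map, hT]
  simpa [hU, hT, hα] using this.symm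

section Central

variable (he : IsGNS φ e) (hφ : IsClassFun φ) (hα : IsPositiveDefiniteFun α)
  (hα' : IsClassFun α) (hβ : IsPositiveDefiniteFun β) (hβ' : IsClassFun β)
  {T S : H →L[ℂ] H} (hT : ∀ g h, ⟪e g, T (e h)⟫_ℂ = α (g⁻¹ * h))
  (hS : ∀ g h, ⟪e g, S (e h)⟫_ℂ = β (g⁻¹ * h))

include he hT hS in
lemma inner_mul_left (a g h : G) :
    ⟪e (a * g), T (S (e (a * h)))⟫_ℂ = ⟪e g, T (S (e h))⟫_ℂ := by
  obtain ⟨U, hU⟩ := he.exists_isometry (Equiv.mulLeft a) (fun g h => by simp [mul_assoc])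
  have h1 := he.isometry_comm hT (Equiv.mulLeft a) (fun g h => by simp [mul_assoc]) hU
  have h2 := he.isometry_comm hS (Equiv.mulLeft a) (fun g h => by simp [mul_assoc]) hU
  simp only [Equiv.coe_mulLeft] at hU
  rw [← hU, ← hU, h2, h1, U.inner_map_map]

include he hφ hα' hβ' hT hS in
lemma inner_mul_right (a g h : G) :
    ⟪e (g * a), T (S (e (h * a)))⟫_ℂ = ⟪e g, T (S (e h))⟫_ℂ := by
  have key : ∀ {γ : G → ℂ}, IsClassFun γ → ∀ g h,
      γ ((Equiv.mulRight a g)⁻¹ * Equiv.mulRight a h) = γ (g⁻¹ * h) := by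
    intro γ hγ g h
    simpa [mul_assoc] using hγ (g⁻¹ * h) a⁻¹
  obtain ⟨U, hU⟩ := he.exists_isometry (Equiv.mulRight a) (key hφ)
  have h1 := he.isometry_comm hT (Equiv.mulRight a) (key hα') hU
  have h2 := he.isometry_comm hS (Equiv.mulRight a) (key hβ') hU
  simp only [Equiv.coe_mulRight] at hU
  rw [← hU, ← hU, h2, h1, U.inner_map_map]

include he hφ hα hα' hβ hT hS in
/-- The operators representing class functions commute. With `J` the conjugation, which fixes
`T (e 1)`, both `⟪T (e 1), S (e h)⟫` and `⟪S (e 1), T (e h)⟫` are equal to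
`⟪S (e 1), R (J (T (e 1)))⟫` where `R` is the right translation by `h`. -/
lemma operator_comm : T * S = S * T := by
  have hTp := he.isPositive hα hT
  have hSp := he.isPositive hβ hS
  obtain ⟨J, hJ⟩ := he.exists_conjugation hφ
  have hJi : ∀ g x, ⟪e g, J x⟫_ℂ = ⟪x, e g⁻¹⟫_ℂ := by
    intro g x
    refine he.induction (p := fun x => ⟪e g, J x⟫_ℂ = ⟪x, e g⁻¹⟫_ℂ)
      (isClosed_eq (by fun_prop) (by fun_prop)) ?_ ?_ ?_ x
    · intro x y hx hy
      simp only [map_add, inner_add_left, inner_add_right, hx, hy]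
    · intro c x hx
      simp only [map_smulₛₗ, inner_smul_left, inner_smul_right, hx]
    · intro h
      rw [hJ, he.inner_eq, he.inner_eq, hφ.mul_comm]
  have hJT : J (T (e 1)) = T (e 1) := by
    refine he.ext_inner fun g => ?_
    rw [hJi, hT, ← inner_conj_symm, hT, ← hα.apply_inv]
    simp
  have key : ∀ h, ⟪e 1, T (S (e h))⟫_ℂ = ⟪e 1, S (T (e h))⟫_ℂ := by
    intro h
    have hr : ∀ {γ : G → ℂ}, IsClassFun γ → ∀ g k,
        γ ((Equiv.mulRight h g)⁻¹ * Equiv.mulRight h k) = γ (g⁻¹ * k) := by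
      intro γ hγ g k
      simpa [mul_assoc] using hγ (g⁻¹ * k) h⁻¹
    obtain ⟨R, hR⟩ := he.exists_isometry (Equiv.mulRight h) (hr hφ)
    have hRT : T (e h) = R (T (e 1)) := by
      rw [← he.isometry_comm hT (Equiv.mulRight h) (hr hα') hR, hR]
      simp
    have h1 : ∀ x, ⟪x, S (e h)⟫_ℂ = ⟪S (e 1), R (J x)⟫_ℂ := by
      intro x
      refine he.induction (p := fun x => ⟪x, S (e h)⟫_ℂ = ⟪S (e 1), R (J x)⟫_ℂ)
        (isClosed_eq (by fun_prop) (by fun_prop)) ?_ ?_ ?_ x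
      · intro x y hx hy
        simp only [map_add, inner_add_left, inner_add_right, hx, hy]
      · intro c x hx
        simp only [map_smulₛₗ, RingHom.id_apply, inner_smul_left, inner_smul_right, hx]
      · intro g
        rw [hJ, hR, hS, ← inner_conj_symm, hS, ← hβ.apply_inv]
        simp
    rw [← hTp.inner_left_eq_inner_right, h1, hJT, ← hRT, hSp.inner_left_eq_inner_right]
  refine he.ext_operator fun h => he.ext_inner fun g => ?_
  have h1 := he.inner_mul_left hT hS g 1 (g⁻¹ * h)
  have h2 := he.inner_mul_left hS hT g 1 (g⁻¹ * h)
  simp only [mul_one, mul_inv_cancel_left] at h1 h2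
  simp [h1, h2, key]

include he hφ hα hα' hβ hT hS in
/-- The product of the operators representing two positive definite class functions represents a
positive definite function. -/
lemma isPositiveDefiniteFun_mul :
    IsPositiveDefiniteFun (fun g => ⟪e 1, T (S (e g))⟫_ℂ) := by
  have hTp := he.isPositive hα hT
  have hSp := he.isPositive hβ hS
  have hpos : (T * S).IsPositive := by
    rw [← ContinuousLinearMap.nonneg_iff_isPositive] at *
    exact Commute.mul_nonneg hTp hSp (he.operator_comm hφ hα hα' hβ hT hS)
  rw [isPositiveDefiniteFun_iff_posSemidef]
  have hM : ∀ g h, ⟪e 1, T (S (e (g⁻¹ * h)))⟫_ℂ = ⟪e g, (T * S) (e h)⟫_ℂ := by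
    intro g h
    simpa using (he.inner_mul_left hT hS g 1 (g⁻¹ * h)).symm
  refine ⟨?_, fun f => ?_⟩
  · ext g h
    simp only [translationMatrix, Matrix.conjTranspose_apply, Matrix.of_apply, hM]
    rw [← hpos.inner_left_eq_inner_right, RCLike.star_def, inner_conj_symm]
  · convert hpos.inner_nonneg_right (Finsupp.linearCombination ℂ e f) using 1
    simp only [inner_linearCombination_apply, ← hM, translationMatrix, Matrix.of_apply]

include he hφ hα' hβ' hT hS in
lemma isClassFun_mul : IsClassFun (fun g => ⟪e 1, T (S (e g))⟫_ℂ) := by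
  intro g h
  have h1 := he.inner_mul_left hT hS h h⁻¹ (g * h⁻¹)
  have h2 := he.inner_mul_right hφ hα' hβ' hT hS h⁻¹ 1 g
  simp only [mul_inv_cancel, one_mul, mul_assoc] at *
  exact h1.trans h2

include he hφ hα' hβ hT hS in
/-- If `α ≤ C φ`, the function represented by the product of the operators of `α` and `β` is
dominated by `C β`. -/
lemma isPositiveDefiniteFun_smul_sub_mul {C : ℝ} (hle : IsPositiveDefiniteFun (C • φ - α)) :
    IsPositiveDefiniteFun (C • β - fun g => ⟪e 1, T (S (e g))⟫_ℂ) := by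
  have hT' : ∀ g h, ⟪e g, ((C : ℂ) • (1 : H →L[ℂ] H) - T) (e h)⟫_ℂ = (C • φ - α) (g⁻¹ * h) := by
    intro g h
    simp [he.inner_eq, hT]
  have hc : IsClassFun (C • φ - α) := fun g h => by simp [hφ g h, hα' g h]
  convert he.isPositiveDefiniteFun_mul hφ hle hc hβ hT' hS using 1
  ext g
  simp [hS]

end Central

end IsGNS

end

/-! ### Domination between positive definite class functions -/

namespace IsPositiveDefiniteFun

variable {φ ψ : G → ℂ}

lemma add (h : IsPositiveDefiniteFun φ) (h' : IsPositiveDefiniteFun ψ) :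
    IsPositiveDefiniteFun (φ + ψ) :=
  fun n g => (h n g).add (h' n g)

lemma smul (h : IsPositiveDefiniteFun φ) {c : ℝ} (hc : 0 ≤ c) :
    IsPositiveDefiniteFun (c • φ) := fun n g => (h n g).smul hc

lemma zero : IsPositiveDefiniteFun (0 : G → ℂ) := fun _ _ => Matrix.PosSemidef.zero

lemma sum {ι : Type*} {s : Finset ι} {f : ι → G → ℂ} (h : ∀ i ∈ s, IsPositiveDefiniteFun (f i)) :
    IsPositiveDefiniteFun (∑ i ∈ s, f i) := by
  classical
  induction s using Finset.induction_on with
  | empty => simpa using zero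
  | insert a s ha ih =>
    rw [Finset.sum_insert ha]
    exact (h a (by simp)).add (ih fun i hi => h i (by simp [hi]))

lemma comp {K : Type*} [Group K] (h : IsPositiveDefiniteFun φ) (f : K →* G) :
    IsPositiveDefiniteFun (φ ∘ f) := by
  intro n g
  simpa using h n (f ∘ g)

lemma one_nonneg (h : IsPositiveDefiniteFun φ) : 0 ≤ φ 1 := by
  simpa [translationMatrix] using
    (isPositiveDefiniteFun_iff_posSemidef.1 h).diag_nonneg (i := (1 : G))

lemma ofReal_re_one (h : IsPositiveDefiniteFun φ) : ((φ 1).re : ℂ) = φ 1 :=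
  Complex.ext rfl (Complex.le_def.1 h.one_nonneg).2

lemma re_one_nonneg (h : IsPositiveDefiniteFun φ) : 0 ≤ (φ 1).re :=
  (Complex.le_def.1 h.one_nonneg).1

lemma norm_le (h : IsPositiveDefiniteFun φ) (g : G) : ‖φ g‖ ≤ (φ 1).re := by
  obtain ⟨H, _, _, _, e, he, -⟩ := h.exists_gns
  have hn : ∀ g, ‖e g‖ ^ 2 = (φ 1).re := by
    intro g
    have h1 := inner_self_eq_norm_sq (𝕜 := ℂ) (e g)
    rw [he, inv_mul_cancel] at h1
    exact h1.symm
  have h2 := norm_inner_le_norm (𝕜 := ℂ) (e 1) (e g)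
  rw [he, inv_one, one_mul] at h2
  nlinarith [hn 1, hn g, norm_nonneg (e 1), norm_nonneg (e g), sq_nonneg (‖e 1‖ - ‖e g‖)]

lemma eq_zero_of_one (h : IsPositiveDefiniteFun φ) (h1 : φ 1 = 0) : φ = 0 := by
  ext g
  have := h.norm_le g
  rw [h1, Complex.zero_re] at this
  simpa using this

/-- A positive definite function that is constant on an infinite set `S` vanishes on `S` if, on
indicator functions of finite subsets of `S`, its quadratic form is at most a multiple of the
squared `ℓ²`-norm. -/
lemma eq_zero_of_infinite (h : IsPositiveDefiniteFun φ) {S : Set G} (hS : S.Infinite) {z : ℂ}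
    (hz : ∀ g ∈ S, φ g = z) (C : ℝ)
    (hC : ∀ t : Finset G, ↑t ⊆ S → (∑ g ∈ t, ∑ k ∈ t, φ (g⁻¹ * k)).re ≤ C * t.card) : z = 0 := by
  obtain ⟨H, _, _, _, e, he, -⟩ := h.exists_gns
  -- Cauchy–Schwarz for `e 1` and the sum of `n` vectors of the orbit: their inner product is `n z`,
  -- while the norm of the sum grows only like `√n`.
  have key : ∀ n : ℕ, n * ‖z‖ ^ 2 ≤ ‖e 1‖ ^ 2 * C := by
    intro n
    obtain ⟨t, htS, rfl⟩ := hS.exists_subset_card_eq n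
    rcases t.eq_empty_or_nonempty with rfl | hne
    · obtain ⟨g, hg⟩ := hS.nonempty
      have := hC {g} (by simpa using hg)
      have h0 := h.re_one_nonneg
      simp only [Finset.sum_singleton, inv_mul_cancel, Finset.card_singleton, Nat.cast_one,
        mul_one] at this
      simpa using mul_nonneg (sq_nonneg ‖e 1‖) (h0.trans this)
    have hpos : (0 : ℝ) < t.card := by exact_mod_cast hne.card_pos
    have h1 : ⟪e 1, ∑ g ∈ t, e g⟫_ℂ = t.card * z := by
      rw [inner_sum, Finset.sum_congr rfl (g := fun _ => z)]
      · simp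
      · intro g hg
        rw [he, inv_one, one_mul, hz g (htS hg)]
    have h2 : ‖∑ g ∈ t, e g‖ ^ 2 ≤ C * t.card := by
      refine le_trans (le_of_eq ?_) (hC t htS)
      rw [← inner_self_eq_norm_sq (𝕜 := ℂ)]
      simp only [sum_inner, inner_sum, he]
      rw [Finset.sum_comm]
      rfl
    have h3 := norm_inner_le_norm (𝕜 := ℂ) (e 1) (∑ g ∈ t, e g)
    rw [h1, norm_mul, Complex.norm_natCast] at h3
    have h4 := pow_le_pow_left₀ (by positivity) h3 2
    rw [mul_pow, mul_pow] at h4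
    have h5 : (t.card : ℝ) * (t.card * ‖z‖ ^ 2) ≤ t.card * (‖e 1‖ ^ 2 * C) := by
      nlinarith [mul_le_mul_of_nonneg_left h2 (sq_nonneg ‖e 1‖)]
    exact le_of_mul_le_mul_left h5 hpos
  by_contra hne
  have hz0 : 0 < ‖z‖ ^ 2 := by positivity
  obtain ⟨n, hn⟩ := exists_nat_gt (‖e 1‖ ^ 2 * C / ‖z‖ ^ 2)
  rw [div_lt_iff₀ hz0] at hn
  exact absurd (key n) (not_le.2 hn)

end IsPositiveDefiniteFun

section Extremal

variable {φ θ : G → ℂ}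

/-- A positive definite class function dominated by a multiple of a character is proportional to
this character. -/
theorem exists_eq_smul_of_le_character (hφ : φ ∈ groupCharacters G)
    (hθ : IsPositiveDefiniteFun θ) (hθ' : IsClassFun θ) {C : ℝ}
    (hle : IsPositiveDefiniteFun (C • φ - θ)) : ∃ t : ℝ, 0 ≤ t ∧ θ = t • φ := by
  obtain ⟨⟨hφp, hφ1, hφc⟩, hext⟩ := hφ
  set t := (θ 1).re with ht
  have hθ1 : θ 1 = t := hθ.ofReal_re_one.symm
  have ht0 : 0 ≤ t := hθ.re_one_nonneg
  refine ⟨t, ht0, ?_⟩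
  rcases ht0.eq_or_lt with h0 | h0
  · rw [← h0, zero_smul]
    exact hθ.eq_zero_of_one (by rw [hθ1, ← h0, Complex.ofReal_zero])
  have hCt : t ≤ C := by
    have := hle.re_one_nonneg
    simpa [hφ1, hθ1] using this
  -- Enlarging the constant keeps the second summand of the convex combination nonzero.
  have hD : 0 < C + 1 - t := by linarith
  have hD' : 0 < C + 1 := by linarith
  have hle' : IsPositiveDefiniteFun ((C + 1) • φ - θ) := by
    convert hle.add hφp using 1
    rw [add_smul, one_smul]
    abel
  have h1 : t⁻¹ • θ ∈ groupTraces G :=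
    ⟨hθ.smul (inv_nonneg.2 ht0), by simp [hθ1, h0.ne'], fun g h => by simp [hθ' g h]⟩
  have h2 : (C + 1 - t)⁻¹ • ((C + 1) • φ - θ) ∈ groupTraces G := by
    refine ⟨hle'.smul (inv_nonneg.2 hD.le), ?_, fun g h => by simp [hθ' g h, hφc g h]⟩
    have : ((C : ℂ) + 1 - t) ≠ 0 := by exact_mod_cast hD.ne'
    simp [hφ1, hθ1, this]
  have h3 : φ ∈ openSegment ℝ (t⁻¹ • θ) ((C + 1 - t)⁻¹ • ((C + 1) • φ - θ)) := by
    refine ⟨t / (C + 1), (C + 1 - t) / (C + 1), by positivity, by positivity, by field_simp; ring,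
      ?_⟩
    rw [smul_smul, smul_smul, div_mul_eq_mul_div, div_mul_eq_mul_div, mul_inv_cancel₀ h0.ne',
      mul_inv_cancel₀ hD.ne', ← smul_add, add_sub_cancel, smul_smul, one_div,
      inv_mul_cancel₀ hD'.ne', one_smul]
  have h4 := hext h1 h2 h3
  rw [← h4, smul_smul, mul_inv_cancel₀ h0.ne', one_smul]

end Extremal

/-- Riesz decomposition for positive definite class functions: a function dominated by a finite
sum is a sum of functions dominated by the summands. -/
theorem riesz_decomposition {ι : Type*} {s : Finset ι} {α : G → ℂ} {β : ι → G → ℂ}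
    (hα : IsPositiveDefiniteFun α) (hα' : IsClassFun α)
    (hβ : ∀ i ∈ s, IsPositiveDefiniteFun (β i)) (hβ' : ∀ i ∈ s, IsClassFun (β i))
    (hle : IsPositiveDefiniteFun (∑ i ∈ s, β i - α)) :
    ∃ a : ι → G → ℂ, (∀ i ∈ s, IsPositiveDefiniteFun (a i) ∧ IsClassFun (a i) ∧
      IsPositiveDefiniteFun (β i - a i)) ∧ α = ∑ i ∈ s, a i := by
  classical
  set γ := ∑ i ∈ s, β i with hγ
  have hγp : IsPositiveDefiniteFun γ := IsPositiveDefiniteFun.sum hβ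
  have hγc : IsClassFun γ := by
    intro g h
    simp only [hγ, Finset.sum_apply]
    exact Finset.sum_congr rfl fun i hi => hβ' i hi g h
  obtain ⟨H, _, _, _, e, he, hd⟩ := hγp.exists_gns
  have hG : IsGNS γ e := ⟨he, hd⟩
  have hle1 : IsPositiveDefiniteFun ((1 : ℝ) • γ - α) := by rwa [one_smul]
  obtain ⟨T, hT⟩ := hG.exists_operator hα hle1
  have hP : ∀ i, ∃ P : H →L[ℂ] H, i ∈ s → ∀ g h, ⟪e g, P (e h)⟫_ℂ = β i (g⁻¹ * h) := by
    intro i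
    by_cases hi : i ∈ s
    · have : IsPositiveDefiniteFun ((1 : ℝ) • γ - β i) := by
        rw [one_smul, hγ, ← Finset.add_sum_erase s β hi, add_sub_cancel_left]
        exact IsPositiveDefiniteFun.sum fun j hj => hβ j (Finset.mem_of_mem_erase hj)
      obtain ⟨P, hP⟩ := hG.exists_operator (hβ i hi) this
      exact ⟨P, fun _ => hP⟩
    · exact ⟨0, fun h => absurd h hi⟩
  choose P hP using hP
  have hsum : ∀ g, ∑ i ∈ s, P i (e g) = e g := by
    intro g
    refine hG.ext_inner fun h => ?_
    rw [inner_sum, he, hγ, Finset.sum_apply]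
    exact Finset.sum_congr rfl fun i hi => hP i hi h g
  refine ⟨fun i g => ⟪e 1, T (P i (e g))⟫_ℂ, fun i hi => ⟨?_, ?_, ?_⟩, ?_⟩
  · exact hG.isPositiveDefiniteFun_mul hγc hα hα' (hβ i hi) hT (hP i hi)
  · exact hG.isClassFun_mul hγc hα' (hβ' i hi) hT (hP i hi)
  · simpa using hG.isPositiveDefiniteFun_smul_sub_mul hγc hα' (hβ i hi) hT (hP i hi)
      hle1
  · ext g
    rw [Finset.sum_apply, ← inner_sum, ← map_sum, hsum, hT, inv_one, one_mul]

/-! ### Traces on a group and on a normal subgroup of finite index -/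

lemma isClosed_setOf_isPositiveDefiniteFun :
    IsClosed {φ : G → ℂ | IsPositiveDefiniteFun φ} := by
  simp only [isPositiveDefiniteFun_iff_posSemidef, Matrix.PosSemidef, Set.ofPred_and,
    Set.ofPred_forall]
  refine IsClosed.inter ?_ (isClosed_iInter fun f => isClosed_le continuous_const ?_)
  · simp only [Matrix.IsHermitian, Matrix.ext_iff.symm, Set.ofPred_forall]
    refine isClosed_iInter fun g => isClosed_iInter fun h => isClosed_eq ?_ ?_ <;>
    simp only [translationMatrix, Matrix.conjTranspose_apply, Matrix.of_apply] <;> fun_prop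
  · simp only [translationMatrix, Matrix.of_apply, Finsupp.sum]
    fun_prop

lemma isCompact_groupTraces : IsCompact (groupTraces G) := by
  refine IsCompact.of_isClosed_subset
    (isCompact_univ_pi fun _ : G => isCompact_closedBall (0 : ℂ) 1) ?_ ?_
  · refine isClosed_setOf_isPositiveDefiniteFun.inter (IsClosed.inter ?_ ?_)
    · exact isClosed_eq (by fun_prop) (by fun_prop)
    · have : {φ : G → ℂ | IsClassFun φ} = ⋂ g, ⋂ h, {φ : G → ℂ | φ (h * g * h⁻¹) = φ g} := by
        ext φ
        simp [IsClassFun]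
      have hc : IsClosed {φ : G → ℂ | IsClassFun φ} := by
        rw [this]
        exact isClosed_iInter fun g => isClosed_iInter fun h =>
          isClosed_eq (by fun_prop) (by fun_prop)
      exact hc
  · intro φ hφ g _
    simpa [hφ.2.1] using hφ.1.norm_le g

/-- Lifting extreme points through a continuous linear map: the fibre of an extreme point is a
compact extreme subset of the traces, hence contains a character by the Krein–Milman theorem. -/
theorem exists_mem_groupCharacters_map_eq {K : Type*} {S : Set (K → ℂ)}
    (A : (G → ℂ) →ₗ[ℝ] (K → ℂ)) (hA : Continuous A) (hAS : ∀ φ ∈ groupTraces G, A φ ∈ S)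
    {p : K → ℂ} (hp : p ∈ S.extremePoints ℝ) (hne : ∃ φ ∈ groupTraces G, A φ = p) :
    ∃ φ ∈ groupCharacters G, A φ = p := by
  have hext : IsExtreme ℝ (groupTraces G) (groupTraces G ∩ A ⁻¹' {p}) := by
    refine ⟨Set.inter_subset_left, fun φ hφ ψ hψ χ hχ hseg => ⟨hφ, ?_⟩⟩
    refine hp.2 (hAS φ hφ) (hAS ψ hψ) ?_
    obtain ⟨a, b, ha, hb, hab, rfl⟩ := hseg
    refine ⟨a, b, ha, hb, hab, ?_⟩
    rw [← map_smul, ← map_smul, ← map_add]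
    exact hχ.2
  have hcomp : IsCompact (groupTraces G ∩ A ⁻¹' {p}) :=
    isCompact_groupTraces.inter_right (isClosed_singleton.preimage hA)
  obtain ⟨φ, hφ⟩ := hcomp.extremePoints_nonempty (by obtain ⟨φ, h1, h2⟩ := hne; exact ⟨φ, h1, h2⟩)
  exact ⟨φ, hext.extremePoints_subset_extremePoints hφ, hφ.1.2⟩

section Normal

variable (N : Subgroup G)

/-- Restriction of functions from `G` to the subgroup `N`. -/
noncomputable def restrictTo : (G → ℂ) →ₗ[ℝ] (N → ℂ) := LinearMap.funLeft ℝ ℂ ((↑) : N → G)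

@[simp] lemma restrictTo_apply (φ : G → ℂ) (n : N) : restrictTo N φ n = φ n := rfl

lemma continuous_restrictTo : Continuous (restrictTo N) :=
  continuous_pi fun n => continuous_apply (n : G)

lemma restrictTo_mem_groupTraces {φ : G → ℂ} (hφ : φ ∈ groupTraces G) :
    restrictTo N φ ∈ groupTraces N :=
  ⟨hφ.1.comp N.subtype, hφ.2.1, fun g h => hφ.2.2 g h⟩

variable {N}

/-- Extension by zero of functions from the subgroup `N` to `G`. -/
noncomputable def zeroExtension (α : N → ℂ) : G → ℂ := Function.extend ((↑) : N → G) α 0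

lemma zeroExtension_coe (α : N → ℂ) (n : N) : zeroExtension α n = α n :=
  Subtype.val_injective.extend_apply _ _ _

lemma zeroExtension_of_notMem (α : N → ℂ) {g : G} (hg : g ∉ N) : zeroExtension α g = 0 :=
  Function.extend_apply' _ _ _ (by rintro ⟨n, rfl⟩; exact hg n.2)

lemma zeroExtension_add_smul (a b : ℝ) (α β : N → ℂ) :
    zeroExtension (a • α + b • β) = a • zeroExtension α + b • zeroExtension β := by
  ext g
  by_cases hg : g ∈ N
  · lift g to N using hg
    simp [zeroExtension_coe]
  · simp [zeroExtension_of_notMem _ hg]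

/-- The matrix of the extension by zero is block diagonal with respect to the cosets of `N`. -/
lemma IsPositiveDefiniteFun.zeroExtension {α : N → ℂ} (hα : IsPositiveDefiniteFun α) :
    IsPositiveDefiniteFun (zeroExtension α) := by
  classical
  let q : G → G ⧸ N := fun g => g
  have hr : ∀ g, (q g).out⁻¹ * g ∈ N := fun g => by
    rw [← QuotientGroup.eq]
    exact Quotient.out_eq _
  let r : G → N := fun g => ⟨_, hr g⟩
  rw [isPositiveDefiniteFun_iff_posSemidef] at hα ⊢
  have hM : translationMatrix (_root_.zeroExtension α) =
      ((translationMatrix α).submatrix r r).hadamard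
        ((1 : Matrix (G ⧸ N) (G ⧸ N) ℂ).submatrix q q) := by
    ext g h
    simp only [translationMatrix, Matrix.of_apply, Matrix.hadamard_apply, Matrix.submatrix_apply,
      Matrix.one_apply]
    by_cases hgh : q g = q h
    · have h1 : ((r g)⁻¹ * r h : N) = g⁻¹ * h := by
        simp [r, hgh, mul_assoc]
      rw [if_pos hgh, mul_one, ← h1, zeroExtension_coe]
    · rw [if_neg hgh, mul_zero, zeroExtension_of_notMem]
      rwa [← QuotientGroup.eq]
  rw [hM]
  exact (hα.submatrix r).hadamard (Matrix.PosSemidef.one.submatrix q)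

/-- A positive definite function is dominated by the index of `N` times its truncation to `N`. -/
lemma IsPositiveDefiniteFun.card_smul_zeroExtension_sub [Fintype (G ⧸ N)] {φ : G → ℂ}
    (hφ : IsPositiveDefiniteFun φ) : IsPositiveDefiniteFun
      ((Fintype.card (G ⧸ N) : ℝ) • _root_.zeroExtension (restrictTo N φ) - φ) := by
  classical
  let q : G → G ⧸ N := fun g => g
  let J : Matrix (G ⧸ N) (G ⧸ N) ℂ := .of fun _ _ => 1
  let m : ℂ := Fintype.card (G ⧸ N)
  have hJJ : J * J = m • J := by
    ext i j
    simp [J, Matrix.mul_apply, m]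
  have hJs : J.conjTranspose = J := by
    ext i j
    simp [J]
  have hm : m ≠ 0 := by simp [m]
  -- `m • 1 - J` is `m` times an orthogonal projection.
  have hJ : (m • 1 - J).PosSemidef := by
    have h1 := (Matrix.posSemidef_conjTranspose_mul_self (m • 1 - J)).smul (a := m⁻¹) (by simp [m])
    convert h1 using 1
    rw [Matrix.conjTranspose_sub, hJs, Matrix.conjTranspose_smul, Matrix.conjTranspose_one]
    have : star m = m := by simp [m]
    rw [this, sub_mul, mul_sub, mul_sub, hJJ]
    simp only [Matrix.smul_mul, Matrix.mul_smul, Matrix.one_mul, Matrix.mul_one, sub_self, sub_zero,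
      smul_sub, smul_smul, inv_mul_cancel_left₀ hm, inv_mul_cancel₀ hm, one_smul]
  rw [isPositiveDefiniteFun_iff_posSemidef] at hφ ⊢
  have hM : translationMatrix ((Fintype.card (G ⧸ N) : ℝ) • _root_.zeroExtension (restrictTo N φ)
      - φ) = (translationMatrix φ).hadamard ((m • 1 - J).submatrix q q) := by
    ext g h
    simp only [translationMatrix, Matrix.of_apply, Matrix.hadamard_apply, Matrix.submatrix_apply,
      Matrix.sub_apply, Matrix.smul_apply, Matrix.one_apply, Pi.sub_apply, Pi.smul_apply, J]
    by_cases hgh : q g = q h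
    · obtain ⟨n, hn⟩ : ∃ n : N, (n : G) = g⁻¹ * h := ⟨⟨_, QuotientGroup.eq.1 hgh⟩, rfl⟩
      rw [if_pos hgh, ← hn, zeroExtension_coe]
      simp [m]
      ring
    · rw [if_neg hgh, zeroExtension_of_notMem]
      · simp
      · rwa [← QuotientGroup.eq]
  rw [hM]
  exact hφ.hadamard (hJ.submatrix q)

variable [N.Normal]

/-- The action of `x : G` on functions on the normal subgroup `N` by conjugation:
`(conjBy x α) n = α (x⁻¹ n x)`. -/
noncomputable def conjBy (x : G) : (N → ℂ) →ₗ[ℝ] (N → ℂ) :=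
  LinearMap.funLeft ℝ ℂ (MulAut.conjNormal x⁻¹ : N ≃* N)

lemma conjBy_apply (x : G) (α : N → ℂ) (n : N) :
    conjBy x α n = α (MulAut.conjNormal x⁻¹ n) := rfl

lemma conjBy_mul (x y : G) (α : N → ℂ) : conjBy (x * y) α = conjBy x (conjBy y α) := by
  ext n
  simp [conjBy_apply, mul_inv_rev]

lemma conjBy_coe {α : N → ℂ} (hα : IsClassFun α) (n : N) : conjBy (n : G) α = α := by
  ext k
  rw [conjBy_apply, ← hα k n⁻¹]
  congr 1

lemma conjBy_inv_conjBy {α : N → ℂ} (x : G) : conjBy x⁻¹ (conjBy x α) = α := by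
  ext n
  simp [conjBy_apply]

lemma conjBy_conjBy_inv {α : N → ℂ} (x : G) : conjBy x (conjBy x⁻¹ α) = α := by
  ext n
  simp [conjBy_apply]

lemma conjBy_eq_of_coe_eq {α : N → ℂ} (hα : IsClassFun α) {x y : G} (h : (x : G ⧸ N) = y) :
    conjBy x α = conjBy y α := by
  obtain ⟨n, hn⟩ : ∃ n : N, (n : G) = x⁻¹ * y := ⟨⟨_, QuotientGroup.eq.1 h⟩, rfl⟩
  rw [← mul_inv_cancel_left x y, ← hn, conjBy_mul, conjBy_coe hα]

lemma IsPositiveDefiniteFun.conjBy {α : N → ℂ} (hα : IsPositiveDefiniteFun α) (x : G) :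
    IsPositiveDefiniteFun (conjBy x α) :=
  hα.comp (MulAut.conjNormal x⁻¹ : N ≃* N).toMonoidHom

lemma IsClassFun.conjBy {α : N → ℂ} (hα : IsClassFun α) (x : G) : IsClassFun (conjBy x α) := by
  intro g h
  simp only [conjBy_apply, map_mul, map_inv]
  exact hα _ _

variable (N) in
/-- The traces on the normal subgroup `N` that are invariant under conjugation by `G`. -/
def invariantTraces : Set (N → ℂ) := {α ∈ groupTraces N | ∀ x : G, conjBy x α = α}

lemma restrictTo_mem_invariantTraces {φ : G → ℂ} (hφ : φ ∈ groupTraces G) :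
    restrictTo N φ ∈ invariantTraces N := by
  refine ⟨restrictTo_mem_groupTraces N hφ, fun x => ?_⟩
  ext n
  simp only [conjBy_apply, restrictTo_apply, MulAut.conjNormal_apply]
  exact hφ.2.2 _ _

lemma zeroExtension_isClassFun {α : N → ℂ} (hα : ∀ x : G, conjBy x α = α) :
    IsClassFun (zeroExtension α) := by
  intro g h
  by_cases hg : g ∈ N
  · lift g to N using hg
    have : h * g * h⁻¹ = (MulAut.conjNormal h g : N) := by simp
    rw [this, zeroExtension_coe, zeroExtension_coe, ← congrFun (hα h⁻¹) g, conjBy_apply, inv_inv]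
  · rw [zeroExtension_of_notMem _ hg, zeroExtension_of_notMem]
    rwa [← Subgroup.Normal.mem_comm_iff ‹_›, inv_mul_cancel_left]

lemma zeroExtension_mem_groupTraces {α : N → ℂ} (hα : α ∈ invariantTraces N) :
    zeroExtension α ∈ groupTraces G :=
  ⟨hα.1.1.zeroExtension, by rw [← N.coe_one, zeroExtension_coe, hα.1.2.1],
    zeroExtension_isClassFun hα.2⟩

omit [N.Normal] in
lemma restrictTo_zeroExtension (α : N → ℂ) : restrictTo N (zeroExtension α) = α := by
  ext n
  rw [restrictTo_apply, zeroExtension_coe]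

section Average

variable [Fintype (G ⧸ N)]

variable (N) in
/-- The average of a function on `N` over the conjugation action of `G ⧸ N`, computed on coset
representatives; it is independent of their choice for class functions. -/
noncomputable def conjAverage : (N → ℂ) →ₗ[ℝ] (N → ℂ) :=
  (Fintype.card (G ⧸ N) : ℝ)⁻¹ • ∑ q : G ⧸ N, conjBy q.out

lemma conjAverage_apply (α : N → ℂ) : conjAverage N α =
    ∑ q : G ⧸ N, (Fintype.card (G ⧸ N) : ℝ)⁻¹ • conjBy q.out α := by
  simp [conjAverage, Finset.smul_sum]

lemma continuous_conjAverage : Continuous (conjAverage N) := by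
  have : ∀ α, conjAverage N α = ∑ q : G ⧸ N, (Fintype.card (G ⧸ N) : ℝ)⁻¹ • conjBy q.out α :=
    conjAverage_apply
  rw [funext this]
  refine continuous_finsetSum _ fun q _ => ?_
  have : Continuous (conjBy q.out : (N → ℂ) →ₗ[ℝ] (N → ℂ)) :=
    continuous_pi fun n => continuous_apply _
  exact this.const_smul (Fintype.card (G ⧸ N) : ℝ)⁻¹

lemma conjAverage_eq_self {α : N → ℂ} (hα : ∀ x : G, conjBy x α = α) : conjAverage N α = α := by
  rw [conjAverage_apply]
  simp only [hα]
  rw [Finset.sum_const, Finset.card_univ, ← Nat.cast_smul_eq_nsmul ℝ, smul_smul,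
    mul_inv_cancel₀ (by simp), one_smul]

lemma conjBy_conjAverage {α : N → ℂ} (hα : IsClassFun α) (x : G) :
    conjBy x (conjAverage N α) = conjAverage N α := by
  rw [conjAverage_apply, map_sum]
  refine Fintype.sum_equiv (Equiv.mulLeft (x : G ⧸ N)) _ _ fun q => ?_
  rw [map_smul, ← conjBy_mul]
  congr 1
  refine conjBy_eq_of_coe_eq hα ?_
  simp

lemma conjAverage_conjBy {α : N → ℂ} (hα : IsClassFun α) (x : G) :
    conjAverage N (conjBy x α) = conjAverage N α := by
  rw [conjAverage_apply, conjAverage_apply]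
  refine Fintype.sum_equiv (Equiv.mulRight (x : G ⧸ N)) _ _ fun q => ?_
  rw [← conjBy_mul]
  congr 1
  refine conjBy_eq_of_coe_eq hα ?_
  simp

lemma conjAverage_mem_invariantTraces {α : N → ℂ} (hα : α ∈ groupTraces N) :
    conjAverage N α ∈ invariantTraces N := by
  refine ⟨⟨?_, ?_, ?_⟩, conjBy_conjAverage hα.2.2⟩
  · rw [conjAverage_apply]
    exact IsPositiveDefiniteFun.sum fun q _ => (hα.1.conjBy _).smul (by positivity)
  · rw [conjAverage_apply]
    simp [conjBy_apply, hα.2.1]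
  · intro g h
    rw [conjAverage_apply]
    simp only [Finset.sum_apply, Pi.smul_apply]
    exact Finset.sum_congr rfl fun q _ => by rw [IsClassFun.conjBy hα.2.2 q.out g h]

lemma card_smul_conjAverage_sub {α : N → ℂ} (hα : α ∈ groupTraces N) :
    IsPositiveDefiniteFun ((Fintype.card (G ⧸ N) : ℝ) • conjAverage N α - α) := by
  classical
  have h1 : (Fintype.card (G ⧸ N) : ℝ) • conjAverage N α = ∑ q : G ⧸ N, conjBy q.out α := by
    rw [conjAverage_apply, Finset.smul_sum]
    exact Finset.sum_congr rfl fun q _ => by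
      rw [smul_smul, mul_inv_cancel₀ (by simp), one_smul]
  have h2 : conjBy (1 : G ⧸ N).out α = α := by
    rw [conjBy_eq_of_coe_eq (y := 1) hα.2.2 (by simp)]
    exact conjBy_coe hα.2.2 1
  rw [h1, ← Finset.add_sum_erase _ _ (Finset.mem_univ (1 : G ⧸ N)), h2, add_sub_cancel_left]
  exact IsPositiveDefiniteFun.sum fun q _ => hα.1.conjBy _

/-- The average of a character of `N` is extreme among the `G`-invariant traces: by Riesz
decomposition, whatever it dominates is a combination of conjugates of this character. -/
theorem conjAverage_mem_extremePoints {φ : N → ℂ} (hφ : φ ∈ groupCharacters N) :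
    conjAverage N φ ∈ (invariantTraces N).extremePoints ℝ := by
  refine ⟨conjAverage_mem_invariantTraces hφ.1, ?_⟩
  rintro α hα β hβ ⟨a, b, ha, hb, hab, hsum⟩
  have hφt := hφ.1
  have hle : IsPositiveDefiniteFun
      (∑ q : G ⧸ N, (Fintype.card (G ⧸ N) : ℝ)⁻¹ • conjBy q.out φ - a • α) := by
    rw [← conjAverage_apply, ← hsum, add_sub_cancel_left]
    exact hβ.1.1.smul hb.le
  obtain ⟨c, hc, hac⟩ := riesz_decomposition (hα.1.1.smul ha.le)
    (fun g h => by simp [hα.1.2.2 g h])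
    (fun q _ => (hφt.1.conjBy q.out).smul (by positivity))
    (fun q _ g h => by
      rw [Pi.smul_apply, Pi.smul_apply, IsClassFun.conjBy hφt.2.2 q.out g h]) hle
  have ht : ∀ q : G ⧸ N, ∃ t : ℝ, c q = t • conjBy q.out φ := by
    intro q
    obtain ⟨h1, h2, h3⟩ := hc q (Finset.mem_univ q)
    have h4 := h3.conjBy q.out⁻¹
    rw [map_sub, map_smul, conjBy_inv_conjBy] at h4
    obtain ⟨t, -, ht⟩ := exists_eq_smul_of_le_character hφ (h1.conjBy _) (h2.conjBy _) h4
    exact ⟨t, by rw [← map_smul, ← ht, conjBy_conjBy_inv]⟩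
  choose t ht using ht
  have h1 : a • α = (∑ q, t q) • conjAverage N φ := by
    rw [← conjAverage_eq_self hα.2, ← map_smul, hac, map_sum, Finset.sum_smul]
    refine Finset.sum_congr rfl fun q _ => ?_
    rw [ht, map_smul, conjAverage_conjBy hφt.2.2]
  have h2 : a = ∑ q, t q := by
    have := congrFun h1 1
    simp only [Pi.smul_apply, hα.1.2.1, (conjAverage_mem_invariantTraces hφt).1.2.1,
      Complex.real_smul, mul_one] at this
    exact_mod_cast this
  rw [← h2] at h1
  exact smul_right_injective _ ha.ne' h1

end Average

end Normal

/-! ### Restrictions of characters -/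

section

variable {N : Subgroup G}

/-- If `γ` is supported on `N`, the GNS space of `γ` is the orthogonal sum of the closed spans of
the vectors `e g` with `g ∈ N` and with `g ∉ N`. -/
lemma IsGNS.inner_eq_zero_of_support {H : Type*} [NormedAddCommGroup H] [InnerProductSpace ℂ H]
    [CompleteSpace H] {γ : G → ℂ} {e : G → H} (he : IsGNS γ e) (hγ : ∀ g ∉ N, γ g = 0) {u v : H}
    (hu : ∀ g ∉ N, ⟪e g, u⟫_ℂ = 0) (hv : ∀ g ∈ N, ⟪e g, v⟫_ℂ = 0) : ⟪u, v⟫_ℂ = 0 := by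
  let A : Submodule ℂ H := (Submodule.span ℂ (e '' (N : Set G))).topologicalClosure
  have hA : ∀ {x : H}, x ∈ Aᗮ ↔ ∀ g ∈ N, ⟪e g, x⟫_ℂ = 0 := by
    intro x
    rw [Submodule.orthogonal_closure, Submodule.mem_orthogonal]
    constructor
    · intro h g hg
      exact h _ (Submodule.subset_span ⟨g, hg, rfl⟩)
    · intro h y hy
      induction hy using Submodule.span_induction with
      | mem y hy => obtain ⟨g, hg, rfl⟩ := hy; exact h g hg
      | zero => simp
      | add a b _ _ ha hb => rw [inner_add_left, ha, hb, add_zero]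
      | smul c a _ ha => rw [inner_smul_left, ha, mul_zero]
  have hAc : IsClosed (A : Set H) := Submodule.isClosed_topologicalClosure _
  have : CompleteSpace A := hAc.completeSpace_coe
  have heA : ∀ g ∈ N, e g ∈ A := fun g hg =>
    Submodule.le_topologicalClosure _ (Submodule.subset_span ⟨g, hg, rfl⟩)
  have heA' : ∀ g ∉ N, e g ∈ Aᗮ := by
    intro g hg
    refine hA.2 fun k hk => ?_
    rw [he.inner_eq]
    refine hγ _ fun h => hg ?_
    simpa using N.mul_mem hk h
  have huA : u ∈ A := by
    have : u = A.starProjection u := by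
      refine he.ext_inner fun g => ?_
      by_cases hg : g ∈ N
      · have h1 := Submodule.sub_starProjection_mem_orthogonal (K := A) u
        have h2 := h1 (e g) (heA g hg)
        rwa [inner_sub_right, sub_eq_zero] at h2
      · rw [hu g hg, Submodule.inner_left_of_mem_orthogonal (K := A)
          (Submodule.starProjection_apply_mem _ _) (heA' g hg)]
    rw [this]
    exact Submodule.starProjection_apply_mem _ _
  exact (hA.2 hv) u huA

variable [N.Normal] [Fintype (G ⧸ N)]

/-- The restriction of a character of `G` is extreme among the `G`-invariant traces on `N`.
In the GNS space of the truncation `γ` of `φ` to `N`, the function `φ` and the extension by zero of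
a `G`-invariant trace dominated by `φ` on `N` are represented by commuting operators `P` and `T`.
Their product represents a multiple of `φ`, whose restriction to `N` is the given trace. -/
theorem restrictTo_mem_extremePoints {φ : G → ℂ} (hφ : φ ∈ groupCharacters G) :
    restrictTo N φ ∈ (invariantTraces N).extremePoints ℝ := by
  have hφt := hφ.1
  have hres := restrictTo_mem_invariantTraces (N := N) hφt
  refine ⟨hres, ?_⟩
  rintro α hα β hβ ⟨a, b, ha, hb, hab, hsum⟩
  set γ := zeroExtension (restrictTo N φ) with hγ
  have hγt : γ ∈ groupTraces G := zeroExtension_mem_groupTraces hres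
  have hαt := zeroExtension_mem_groupTraces hα
  have hβt := zeroExtension_mem_groupTraces hβ
  have hα1 : IsPositiveDefiniteFun (a • zeroExtension α) := hαt.1.smul ha.le
  have hα2 : IsClassFun (a • zeroExtension α) := fun g h => by simp [hαt.2.2 g h]
  have hle : IsPositiveDefiniteFun ((1 : ℝ) • γ - a • zeroExtension α) := by
    rw [hγ, ← hsum, zeroExtension_add_smul, one_smul, add_sub_cancel_left]
    exact hβt.1.smul hb.le
  obtain ⟨H, _, _, _, e, he, hd⟩ := hγt.1.exists_gns
  have hG : IsGNS γ e := ⟨he, hd⟩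
  obtain ⟨T, hT⟩ := hG.exists_operator hα1 hle
  obtain ⟨P, hP⟩ := hG.exists_operator hφt.1 hφt.1.card_smul_zeroExtension_sub
  obtain ⟨t, -, ht⟩ := exists_eq_smul_of_le_character hφ
    (hG.isPositiveDefiniteFun_mul hγt.2.2 hα1 hα2 hφt.1 hT hP)
    (hG.isClassFun_mul hγt.2.2 hα2 hφt.2.2 hT hP)
    (hG.isPositiveDefiniteFun_smul_sub_mul hγt.2.2 hα2 hφt.1 hT hP hle)
  have key : ∀ n : N, a • α n = t • φ n := by
    intro n
    rw [← Pi.smul_apply t φ, ← ht]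
    have h1 : ⟪T (e 1), P (e n) - e n⟫_ℂ = 0 := by
      refine hG.inner_eq_zero_of_support (N := N) (fun g hg => zeroExtension_of_notMem _ hg) ?_ ?_
      · intro g hg
        rw [hT, Pi.smul_apply, zeroExtension_of_notMem, smul_zero]
        simpa using hg
      · intro g hg
        rw [inner_sub_right, hP, he, hγ]
        lift g to N using hg
        rw [← N.coe_inv, ← N.coe_mul, zeroExtension_coe, restrictTo_apply, sub_self]
    have hTp := hG.isPositive hα1 hT
    rw [inner_sub_right, sub_eq_zero, hTp.inner_left_eq_inner_right,
      hTp.inner_left_eq_inner_right, hT, inv_one, one_mul, Pi.smul_apply, zeroExtension_coe] at h1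
    exact h1.symm
  have hat : a = t := by
    have := key 1
    rw [N.coe_one, hφt.2.1, hα.1.2.1] at this
    simpa using this
  ext n
  have := key n
  rw [← hat] at this
  exact smul_right_injective _ ha.ne' this

end

/-! ### Functions of finite rank -/

/-- A function on `G` has finite rank if its quadratic form vanishes on a subspace of finite
codimension. For a positive definite function this means that the GNS space has finite
dimension. -/
def HasFiniteRank (φ : G → ℂ) : Prop :=
  ∃ (k : ℕ) (V : (G →₀ ℂ) →ₗ[ℂ] (Fin k → ℂ)), ∀ f, V f = 0 → quadForm φ f = 0

namespace HasFiniteRank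

lemma of_linearMap {φ : G → ℂ} {W : Type*} [AddCommGroup W] [Module ℂ W] [FiniteDimensional ℂ W]
    (V : (G →₀ ℂ) →ₗ[ℂ] W) (hV : ∀ f, V f = 0 → quadForm φ f = 0) : HasFiniteRank φ :=
  ⟨_, (Module.finBasis ℂ W).equivFun.toLinearMap ∘ₗ V, fun f hf => hV f (by simpa using hf)⟩

lemma mono {φ θ : G → ℂ} (hφ : HasFiniteRank φ) (hθ : IsPositiveDefiniteFun θ) {C : ℝ}
    (hle : IsPositiveDefiniteFun (C • φ - θ)) : HasFiniteRank θ := by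
  obtain ⟨k, V, hV⟩ := hφ
  refine ⟨k, V, fun f hf => le_antisymm ?_ (hθ.quadForm_nonneg f)⟩
  have h := hle.quadForm_nonneg f
  rw [quadForm_sub, quadForm_smul, hV f hf, mul_zero, zero_sub] at h
  exact neg_nonneg.1 h

lemma smul {φ : G → ℂ} (hφ : HasFiniteRank φ) (c : ℝ) : HasFiniteRank (c • φ) := by
  obtain ⟨k, V, hV⟩ := hφ
  exact ⟨k, V, fun f hf => by rw [quadForm_smul, hV f hf, mul_zero]⟩

lemma sum {ι : Type*} [Fintype ι] {φ : ι → G → ℂ} (hφ : ∀ i, HasFiniteRank (φ i)) :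
    HasFiniteRank (∑ i, φ i) := by
  choose k V hV using hφ
  refine of_linearMap (LinearMap.pi V) fun f hf => ?_
  have h1 : quadForm (∑ i, φ i) f = ∑ i, quadForm (φ i) f := by
    simp only [quadForm, Finsupp.sum, Finset.sum_apply, Finset.mul_sum, Finset.sum_mul]
    exact (Finset.sum_congr rfl fun _ _ => Finset.sum_comm).trans Finset.sum_comm
  rw [h1]
  exact Finset.sum_eq_zero fun i _ => hV i f (congrFun hf i)

lemma comp {K : Type*} [Group K] {φ : G → ℂ} (hφ : HasFiniteRank φ) (ι : K →* G) :
    HasFiniteRank (φ ∘ ι) := by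
  obtain ⟨k, V, hV⟩ := hφ
  refine ⟨k, V ∘ₗ Finsupp.lmapDomain ℂ ℂ ι, fun f hf => ?_⟩
  rw [← hV _ hf]
  simp only [quadForm, Finsupp.lmapDomain_apply]
  rw [Finsupp.sum_mapDomain_index (by simp) (by intros; simp [add_mul])]
  refine Finsupp.sum_congr fun g _ => ?_
  rw [Finsupp.sum_mapDomain_index (by simp) (by intros; simp [mul_add])]
  simp

lemma conjAverage {N : Subgroup G} [N.Normal] [Fintype (G ⧸ N)] {α : N → ℂ}
    (hα : HasFiniteRank α) : HasFiniteRank (conjAverage N α) := by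
  rw [conjAverage_apply]
  exact sum fun q => (hα.comp (MulAut.conjNormal q.out⁻¹ : N ≃* N).toMonoidHom).smul _

/-- A positive definite function has finite rank if its restriction to a subgroup of finite index
does, because the GNS space is the sum of finitely many translates of that of the restriction. -/
lemma of_restrictTo {N : Subgroup G} [Fintype (G ⧸ N)] {φ : G → ℂ} (hφ : IsPositiveDefiniteFun φ)
    (h : HasFiniteRank (restrictTo N φ)) : HasFiniteRank φ := by
  classical
  obtain ⟨k, V, hV⟩ := h
  obtain ⟨H, _, _, _, e, he, -⟩ := hφ.exists_gns
  let i : G ⧸ N → N → G := fun q n => q.out * n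
  have hi : ∀ q, Function.Injective (i q) := fun q a b hab => by simpa [i] using hab
  let D : G ⧸ N → (G →₀ ℂ) →ₗ[ℂ] (N →₀ ℂ) := fun q => Finsupp.lcomapDomain (i q) (hi q)
  refine of_linearMap (LinearMap.pi fun q => V ∘ₗ D q) fun f hf => ?_
  have hf' : ∀ q, Finsupp.linearCombination ℂ e
      (Finsupp.mapDomain (i q) (D q f)) = 0 := by
    intro q
    rw [Finsupp.linearCombination_mapDomain]
    have h1 := quadForm_eq_norm_sq (φ := restrictTo N φ) (e := e ∘ i q)
      (fun g h => by simp [he, i, mul_assoc]) (D q f)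
    rw [hV _ (congrFun hf q)] at h1
    have h2 := Complex.ofReal_eq_zero.1 h1.symm
    exact norm_eq_zero.1 (pow_eq_zero_iff two_ne_zero |>.1 h2)
  have hsum : f = ∑ q, Finsupp.mapDomain (i q) (D q f) := by
    ext g
    obtain ⟨n, hn⟩ : ∃ n : N, (n : G) = (g : G ⧸ N).out⁻¹ * g :=
      ⟨⟨_, QuotientGroup.eq.1 (Quotient.out_eq (g : G ⧸ N))⟩, rfl⟩
    have hg : i (g : G ⧸ N) n = g := by simp [i, hn]
    rw [Finsupp.finsetSum_apply, Finset.sum_eq_single (g : G ⧸ N)]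
    · have h1 := Finsupp.mapDomain_apply (hi g) (D g f) n
      rw [hg] at h1
      rw [h1]
      simp [D, Finsupp.lcomapDomain, hg]
    · intro q _ hq
      refine Finsupp.mapDomain_of_notMem_range _ _ ?_
      rintro ⟨m, rfl⟩
      exact hq (by simp [i])
    · simp
  rw [quadForm_eq_norm_sq he, hsum, map_sum, Finset.sum_eq_zero fun q _ => hf' q]
  simp

end HasFiniteRank

lemma IsFinDimCharacter.hasFiniteRank {φ : G → ℂ} (hφ : IsFinDimCharacter φ) :
    HasFiniteRank φ := by
  obtain ⟨n, π, -, hπ⟩ := hφ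
  refine HasFiniteRank.of_linearMap
    (Finsupp.linearCombination ℂ fun g => (π g : Matrix (Fin n) (Fin n) ℂ)) fun f hf => ?_
  have h1 : quadForm φ f = (1 / (n : ℂ)) * Matrix.trace
      (star (Finsupp.linearCombination ℂ (fun g => (π g : Matrix (Fin n) (Fin n) ℂ)) f) *
        Finsupp.linearCombination ℂ (fun g => (π g : Matrix (Fin n) (Fin n) ℂ)) f) := by
    simp only [Finsupp.linearCombination_apply, Finsupp.sum, star_sum, Finset.sum_mul,
      Finset.mul_sum, Matrix.trace_sum, quadForm]
    refine Finset.sum_comm.trans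
      (Finset.sum_congr rfl fun g _ => Finset.sum_congr rfl fun h _ => ?_)
    rw [hπ, map_mul, map_inv, star_smul, Matrix.smul_mul, Matrix.mul_smul, Matrix.trace_smul,
      Matrix.trace_smul]
    simp only [smul_eq_mul, Matrix.UnitaryGroup.mul_val, Matrix.UnitaryGroup.inv_val]
    ring
  rw [h1, hf]
  simp

/-! ### Characters of finite rank -/

lemma isPositiveDefiniteFun_smul_sub {φ θ : G → ℂ} (hφ : IsPositiveDefiniteFun φ)
    (hθ : IsPositiveDefiniteFun θ) {C : ℝ} (h : ∀ f, quadForm θ f ≤ C * quadForm φ f) :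
    IsPositiveDefiniteFun (C • φ - θ) := by
  refine isPositiveDefiniteFun_iff_posSemidef.2 ⟨?_, fun f => ?_⟩
  · ext g k
    have h1 := hφ.apply_inv (k⁻¹ * g)
    have h2 := hθ.apply_inv (k⁻¹ * g)
    simp only [mul_inv_rev, inv_inv] at h1 h2
    simp [translationMatrix, h1, h2]
  · change 0 ≤ quadForm (C • φ - θ) f
    rw [quadForm_sub, quadForm_smul, sub_nonneg]
    exact h f

section LeftRegular

variable {H : Type*} [NormedAddCommGroup H] [InnerProductSpace ℂ H] [CompleteSpace H]
  {φ : G → ℂ} {e : G → H}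

/-- The unitary representation of `G` on a GNS space. -/
lemma IsGNS.exists_representation (he : IsGNS φ e) :
    ∃ L : G → H →ₗᵢ[ℂ] H, (∀ a g, L a (e g) = e (a * g)) ∧ (∀ x, L 1 x = x) ∧
      ∀ a b x, L (a * b) x = L a (L b x) := by
  have h : ∀ a : G, ∃ U : H →ₗᵢ[ℂ] H, ∀ g, U (e g) = e (a * g) := fun a =>
    he.exists_isometry (Equiv.mulLeft a) (fun g h => by simp [mul_assoc])
  choose L hL using h
  refine ⟨L, hL, fun x => ?_, fun a b x => ?_⟩
  · have : (L 1).toContinuousLinearMap = ContinuousLinearMap.id ℂ H :=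
      he.ext_operator fun g => by simp [hL]
    exact DFunLike.congr_fun this x
  · have : (L (a * b)).toContinuousLinearMap =
        (L a).toContinuousLinearMap ∘L (L b).toContinuousLinearMap :=
      he.ext_operator fun g => by simp [hL, mul_assoc]
    exact DFunLike.congr_fun this x

/-- In the GNS space of a trace, the matrix coefficient of a vector in the linear span of the orbit
is dominated by a multiple of the trace, since this vector is obtained from the cyclic one by an
operator commuting with the left translations. -/
lemma IsGNS.exists_coefficient_le (he : IsGNS φ e) (hφ : IsPositiveDefiniteFun φ)
    (hφ' : IsClassFun φ) {L : G → H →ₗᵢ[ℂ] H} (hL : ∀ a g, L a (e g) = e (a * g))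
    (hLm : ∀ a b x, L (a * b) x = L a (L b x)) (p : G →₀ ℂ) {u : H}
    (hu : u = Finsupp.linearCombination ℂ e p) :
    IsPositiveDefiniteFun (fun g => ⟪u, L g u⟫_ℂ) ∧
      ∃ C : ℝ, IsPositiveDefiniteFun (C • φ - fun g => ⟪u, L g u⟫_ℂ) := by
  have hθ : ∀ g h, ⟪L g u, L h u⟫_ℂ = ⟪u, L (g⁻¹ * h) u⟫_ℂ := by
    intro g h
    rw [← (L g).inner_map_map u, ← hLm, mul_inv_cancel_left]
  have hpd : IsPositiveDefiniteFun (fun g => ⟪u, L g u⟫_ℂ) :=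
    isPositiveDefiniteFun_of_inner (fun g => L g u) hθ
  refine ⟨hpd, (∑ y ∈ p.support, ‖p y‖) ^ 2, isPositiveDefiniteFun_smul_sub hφ hpd fun f => ?_⟩
  have hR : ∀ a : G, ∃ U : H →ₗᵢ[ℂ] H, ∀ g, U (e g) = e (g * a) := fun a =>
    he.exists_isometry (Equiv.mulRight a) (fun g h => by
      simpa [mul_assoc] using hφ' (g⁻¹ * h) a⁻¹)
  choose R hR using hR
  have h1 : Finsupp.linearCombination ℂ (fun g => L g u) f =
      ∑ y ∈ p.support, p y • R y (Finsupp.linearCombination ℂ e f) := by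
    simp only [hu, Finsupp.linearCombination_apply, Finsupp.sum, map_sum, map_smul, hL, hR,
      Finset.smul_sum]
    rw [Finset.sum_comm]
    exact Finset.sum_congr rfl fun _ _ => Finset.sum_congr rfl fun _ _ => smul_comm _ _ _
  have h2 : ‖Finsupp.linearCombination ℂ (fun g => L g u) f‖ ≤
      (∑ y ∈ p.support, ‖p y‖) * ‖Finsupp.linearCombination ℂ e f‖ := by
    rw [h1, Finset.sum_mul]
    refine norm_sum_le_of_le _ fun y _ => ?_
    rw [norm_smul, LinearIsometry.norm_map]
  rw [quadForm_eq_norm_sq (e := fun g => L g u) hθ, ← he.norm_sq]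
  have h3 := pow_le_pow_left₀ (norm_nonneg _) h2 2
  rw [mul_pow] at h3
  exact_mod_cast h3

end LeftRegular

lemma HasFiniteRank.finiteDimensional_range {φ : G → ℂ} (hφ : HasFiniteRank φ) {H : Type*}
    [NormedAddCommGroup H] [InnerProductSpace ℂ H] {e : G → H} (he : IsGNS φ e) :
    FiniteDimensional ℂ (LinearMap.range (Finsupp.linearCombination ℂ e)) := by
  obtain ⟨k, V, hV⟩ := hφ
  have hker : LinearMap.ker V ≤ LinearMap.ker (Finsupp.linearCombination ℂ e) := by
    intro f hf
    have h1 := hV f hf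
    rw [← he.norm_sq, Complex.ofReal_eq_zero] at h1
    exact norm_eq_zero.1 (pow_eq_zero_iff two_ne_zero |>.1 h1)
  have : FiniteDimensional ℂ ((G →₀ ℂ) ⧸ LinearMap.ker V) :=
    V.quotKerEquivRange.symm.finiteDimensional
  rw [← Submodule.range_liftQ (LinearMap.ker V) _ hker]
  infer_instance

/-- A character of finite rank is the normalized trace of an irreducible unitary representation,
namely of any minimal invariant subspace `U` of its finite-dimensional GNS space: the normalized
trace on `U` is dominated by a multiple of the character, hence equal to it. -/
theorem isFinDimCharacter_of_hasFiniteRank {φ : G → ℂ} (hφ : φ ∈ groupCharacters G)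
    (hr : HasFiniteRank φ) : IsFinDimCharacter φ := by
  classical
  have hφt := hφ.1
  obtain ⟨H, _, _, _, e, hin, hd⟩ := hφt.1.exists_gns
  have he : IsGNS φ e := ⟨hin, hd⟩
  obtain ⟨L, hL, hL1, hLm⟩ := he.exists_representation
  set F := Finsupp.linearCombination ℂ e with hF
  have hfin : FiniteDimensional ℂ (LinearMap.range F) := hr.finiteDimensional_range he
  have hfin' : ∀ U : Submodule ℂ H, U ≤ LinearMap.range F → FiniteDimensional ℂ U :=
    fun U hU => Submodule.finiteDimensional_of_le hU
  let Inv : Set (Submodule ℂ H) :=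
    {U | U ≤ LinearMap.range F ∧ U ≠ ⊥ ∧ ∀ g, ∀ x ∈ U, L g x ∈ U}
  have hne : LinearMap.range F ∈ Inv := by
    refine ⟨le_rfl, fun hbot => ?_, ?_⟩
    · have h1 : e 1 ∈ LinearMap.range F := ⟨Finsupp.single 1 1, by simp [hF]⟩
      rw [hbot, Submodule.mem_bot] at h1
      have h2 := hin 1 1
      simp [h1, hφt.2.1] at h2
    · rintro g _ ⟨p, rfl⟩
      refine ⟨p.mapDomain (g * ·), ?_⟩
      rw [hF, Finsupp.linearCombination_mapDomain]
      simp [Finsupp.linearCombination_apply, Finsupp.sum, hL]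
  obtain ⟨U, ⟨hUF, hU0, hUL⟩, hmin⟩ :=
    (measure fun U : Submodule ℂ H => Module.finrank ℂ U).wf.has_min Inv ⟨_, hne⟩
  have hUfin := hfin' U hUF
  let n := Module.finrank ℂ U
  have hn : n ≠ 0 := fun h => hU0 (Submodule.finrank_eq_zero.1 h)
  let b : OrthonormalBasis (Fin n) ℂ U := stdOrthonormalBasis ℂ U
  let ρ : G → U →ₗ[ℂ] U := fun g => (L g).toLinearMap.restrict (hUL g)
  have hρ : ∀ g (x : U), (ρ g x : H) = L g x := fun g x => rfl
  have hρ1 : ρ 1 = LinearMap.id := by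
    ext x
    simp [hρ, hL1]
  have hρm : ∀ g h, ρ (g * h) = ρ g ∘ₗ ρ h := by
    intro g h
    ext x
    simp [hρ, hLm]
  let M : G → Matrix (Fin n) (Fin n) ℂ := fun g => LinearMap.toMatrix b.toBasis b.toBasis (ρ g)
  have hMij : ∀ g i j, M g i j = ⟪(b i : H), L g (b j)⟫_ℂ := by
    intro g i j
    simp only [M, LinearMap.toMatrix_apply, OrthonormalBasis.coe_toBasis,
      OrthonormalBasis.coe_toBasis_repr_apply, OrthonormalBasis.repr_apply_apply,
      Submodule.coe_inner, hρ]
  have hM1 : M 1 = 1 := by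
    simp only [M, hρ1]
    exact LinearMap.toMatrix_id _
  have hMm : ∀ g h, M (g * h) = M g * M h := fun g h => by
    simp only [M, hρm]
    exact LinearMap.toMatrix_comp _ _ _ _ _
  have hMs : ∀ g, star (M g) = M g⁻¹ := by
    intro g
    ext i j
    rw [Matrix.star_apply, hMij, hMij, RCLike.star_def, inner_conj_symm,
      ← (L g).inner_map_map (b i : H), ← hLm, mul_inv_cancel, hL1]
  let π : FinDimUnitaryRep G n :=
    { toFun := fun g => ⟨M g, by
        rw [Matrix.mem_unitaryGroup_iff, hMs, ← hMm, mul_inv_cancel, hM1]⟩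
      map_one' := Subtype.ext hM1
      map_mul' := fun g h => Subtype.ext (hMm g h) }
  have hπ : ∀ g, (π g : Matrix (Fin n) (Fin n) ℂ) = M g := fun g => rfl
  refine ⟨n, π, ?_, ?_⟩
  -- A nonzero subrepresentation of `ℂⁿ` gives an invariant subspace of `U`, which is `U` itself by
  -- minimality.
  · let ψ : (Fin n → ℂ) ≃ₗ[ℂ] U := b.toBasis.equivFun.symm
    have hψ : ∀ g v, ψ (π.toRepresentation g v) = ρ g (ψ v) := by
      intro g v
      have h1 := LinearMap.toMatrix_mulVec_repr b.toBasis b.toBasis (ρ g) (ψ v)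
      apply b.toBasis.equivFun.injective
      change b.toBasis.equivFun (b.toBasis.equivFun.symm _) = _
      rw [LinearEquiv.apply_symm_apply]
      change Matrix.toLin' (M g) v = _
      rw [Matrix.toLin'_apply]
      have h2 : ⇑(b.toBasis.repr (ψ v)) = v :=
        b.toBasis.equivFun.apply_symm_apply v
      rw [h2] at h1
      exact h1
    have hFin : Nonempty (Fin n) := ⟨⟨0, Nat.pos_of_ne_zero hn⟩⟩
    refine { exists_pair_ne := ⟨⊥, ⊤, fun h => ?_⟩, eq_bot_or_eq_top := fun S => ?_ }
    · have h1 := congrArg Subrepresentation.toSubmodule h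
      exact bot_ne_top (α := Submodule ℂ (Fin n → ℂ)) h1
    · by_cases hS : S.toSubmodule = ⊥
      · exact Or.inl (Subrepresentation.toSubmodule_injective hS)
      right
      refine Subrepresentation.toSubmodule_injective ?_
      let U' : Submodule ℂ H := (S.toSubmodule.map ψ.toLinearMap).map U.subtype
      have hU'U : U' ≤ U := Submodule.map_subtype_le _ _
      have hU' : U' ∈ Inv := by
        refine ⟨hU'U.trans hUF, fun h => hS ?_, ?_⟩
        · refine (Submodule.eq_bot_iff _).2 fun v hv => ?_
          have h1 : (ψ v : H) ∈ U' := ⟨_, ⟨v, hv, rfl⟩, rfl⟩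
          rw [h, Submodule.mem_bot] at h1
          exact ψ.map_eq_zero_iff.1 (Subtype.ext h1)
        · rintro g _ ⟨_, ⟨v, hv, rfl⟩, rfl⟩
          refine ⟨_, ⟨π.toRepresentation g v, S.apply_mem_toSubmodule g hv, rfl⟩, ?_⟩
          change (ψ (π.toRepresentation g v) : H) = L g (ψ v)
          rw [hψ, hρ]
      have h1 : Module.finrank ℂ U ≤ Module.finrank ℂ U' := not_lt.1 (hmin U' hU')
      have h2 : U' = U := Submodule.eq_of_le_of_finrank_le hU'U h1
      change S.toSubmodule = ⊤
      rw [eq_top_iff]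
      intro v _
      have h3 : (ψ v : H) ∈ U' := by
        rw [h2]
        exact (ψ v).2
      obtain ⟨_, ⟨w, hw, rfl⟩, hw'⟩ := h3
      have h4 : w = v := ψ.injective (Subtype.ext hw')
      exact h4 ▸ hw
  -- The trace on `U` is the sum of the matrix coefficients of the basis vectors, each of which is
  -- dominated by a multiple of `φ`.
  · have hb : ∀ j, ∃ p, F p = (b j : H) := fun j => hUF (b j).2
    choose p hp using hb
    have hco := fun j => he.exists_coefficient_le hφt.1 hφt.2.2 hL hLm (p j) (hp j).symm
    choose hpd C hC using hco
    have htr : ∀ g, (M g).trace = (∑ j, fun g => ⟪(b j : H), L g (b j)⟫_ℂ) g := by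
      intro g
      simp [Matrix.trace, hMij]
    set χ : G → ℂ := ∑ j, fun g => ⟪(b j : H), L g (b j)⟫_ℂ with hχ
    have hχp : IsPositiveDefiniteFun χ := IsPositiveDefiniteFun.sum fun j _ => hpd j
    have hχc : IsClassFun χ := by
      intro g h
      rw [← htr, ← htr, hMm, Matrix.trace_mul_comm, ← hMm, inv_mul_cancel_left]
    have hχle : IsPositiveDefiniteFun ((∑ j, C j) • φ - χ) := by
      rw [hχ, Finset.sum_smul, ← Finset.sum_sub_distrib]
      exact IsPositiveDefiniteFun.sum fun j _ => hC j
    obtain ⟨t, -, ht⟩ := exists_eq_smul_of_le_character hφ hχp hχc hχle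
    have ht1 : t = n := by
      have h1 := congrFun ht 1
      rw [← htr, hM1, Pi.smul_apply, hφt.2.1] at h1
      simp only [Matrix.trace_one, Fintype.card_fin, Complex.real_smul, mul_one] at h1
      exact_mod_cast h1.symm
    intro g
    rw [hπ, htr, ht, ht1]
    have : (n : ℂ) ≠ 0 := by exact_mod_cast hn
    simp [this]

/-! ### ICC groups and character rigidity -/

/-- In an ICC group, the orbits of nontrivial elements under conjugation by a subgroup of finite index
are infinite, since finitely many of their translates cover a conjugacy class. -/
lemma IsICC.infinite_conj (hG : IsICC G) (K : Subgroup G) [K.FiniteIndex] {g : G} (hg : g ≠ 1) :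
    (Set.range fun k : K => (k : G) * g * (k : G)⁻¹).Infinite := by
  intro hfin
  refine hG g hg ?_
  refine (Set.finite_iUnion fun q : G ⧸ K =>
    hfin.image fun x => q.out * x * q.out⁻¹).subset fun x hx => ?_
  obtain ⟨c, rfl⟩ := isConj_iff.1 hx
  obtain ⟨k, hk⟩ : ∃ k : K, (k : G) = (c : G ⧸ K).out⁻¹ * c :=
    ⟨⟨_, QuotientGroup.eq.1 (Quotient.out_eq (c : G ⧸ K))⟩, rfl⟩
  refine Set.mem_iUnion.2 ⟨c, _, ⟨k, rfl⟩, ?_⟩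
  simp [hk, mul_assoc]

lemma IsICC.subgroup (hG : IsICC G) (K : Subgroup G) [K.FiniteIndex] : IsICC K := by
  intro g hg hfin
  refine hG.infinite_conj K (g := g) (by simpa using hg) ((hfin.image Subtype.val).subset ?_)
  rintro _ ⟨k, rfl⟩
  exact ⟨k * g * k⁻¹, isConj_iff.2 ⟨k, rfl⟩, by simp⟩

lemma IsICC.center_eq_bot (hG : IsICC G) : Subgroup.center G = ⊥ := by
  rw [eq_bot_iff]
  intro g hg
  by_contra h
  refine hG g h ((Set.finite_singleton g).subset fun x hx => ?_)
  obtain ⟨c, rfl⟩ := isConj_iff.1 hx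
  rw [Set.mem_singleton_iff, Subgroup.mem_center_iff.1 hg c, mul_inv_cancel_right]

lemma IsICC.isCharacterRigid_iff (hG : IsICC G) : IsCharacterRigid G ↔
    ∀ φ ∈ groupCharacters G, IsFinDimCharacter φ ∨ ∀ g ≠ 1, φ g = 0 := by
  simp [IsCharacterRigid, hG.center_eq_bot]

lemma IsPositiveDefiniteFun.sum_nonneg {φ : G → ℂ} (hφ : IsPositiveDefiniteFun φ)
    (t : Finset G) : 0 ≤ ∑ g ∈ t, ∑ h ∈ t, φ (g⁻¹ * h) := by
  have h := ((isPositiveDefiniteFun_iff_posSemidef.1 hφ).submatrix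
    ((↑) : t → G)).dotProduct_mulVec_nonneg 1
  simpa [dotProduct, Matrix.mulVec, translationMatrix, ← Finset.sum_coe_sort t] using h

lemma sum_eq_card {φ : G → ℂ} (h1 : φ 1 = 1) (t : Finset G)
    (h0 : ∀ g ∈ t, ∀ h ∈ t, g ≠ h → φ (g⁻¹ * h) = 0) :
    ∑ g ∈ t, ∑ h ∈ t, φ (g⁻¹ * h) = t.card := by
  rw [Finset.sum_congr rfl (g := fun _ => (1 : ℂ)), Finset.sum_const, nsmul_eq_mul, mul_one]
  intro g hg
  rw [Finset.sum_eq_single_of_mem g hg, inv_mul_cancel, h1]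
  exact fun h hh hne => h0 g hg h hh hne.symm

/-- On an ICC group, a trace that vanishes on the nontrivial elements of a normal subgroup of
finite index vanishes on all nontrivial elements. -/
lemma IsICC.eq_zero_of_restrictTo (hG : IsICC G) (N : Subgroup G) [N.Normal] [N.FiniteIndex]
    {φ : G → ℂ} (hφ : φ ∈ groupTraces G) (h0 : ∀ n : N, n ≠ 1 → restrictTo N φ n = 0) :
    ∀ g ≠ 1, φ g = 0 := by
  intro g hg
  refine hφ.1.eq_zero_of_infinite (hG.infinite_conj N hg) (z := φ g) ?_ 1 fun t ht => ?_
  · rintro _ ⟨k, rfl⟩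
    exact hφ.2.2 g k
  · rw [sum_eq_card hφ.2.1 t, one_mul, Complex.natCast_re]
    intro a ha b hb hab
    have hq : ∀ x ∈ t, (x : G ⧸ N) = g := by
      intro x hx
      obtain ⟨k, rfl⟩ := ht hx
      simp [(QuotientGroup.eq_one_iff (k : G)).2 k.2]
    have hmem : a⁻¹ * b ∈ N := QuotientGroup.eq.1 ((hq a ha).trans (hq b hb).symm)
    refine h0 ⟨_, hmem⟩ fun h => hab ?_
    exact inv_mul_eq_one.1 (congrArg Subtype.val h)

/-- On an ICC group, a trace dominated by a multiple of the regular trace is the regular trace. -/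
lemma IsICC.eq_zero_of_le (hG : IsICC G) {φ ψ : G → ℂ} (hφ : φ ∈ groupTraces G)
    (hψ : ψ ∈ groupTraces G) {C : ℝ} (hle : IsPositiveDefiniteFun (C • ψ - φ))
    (h0 : ∀ g ≠ 1, ψ g = 0) : ∀ g ≠ 1, φ g = 0 := by
  intro g hg
  refine hφ.1.eq_zero_of_infinite (hG g hg) (z := φ g) ?_ C fun t _ => ?_
  · intro x hx
    obtain ⟨c, rfl⟩ := isConj_iff.1 hx
    exact hφ.2.2 g c
  · have h1 := (Complex.le_def.1 (hle.sum_nonneg t)).1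
    have h2 := sum_eq_card hψ.2.1 t fun a _ b _ hab => h0 _ fun h => hab (inv_mul_eq_one.1 h)
    simp only [Pi.sub_apply, Pi.smul_apply, Finset.sum_sub_distrib, ← Finset.smul_sum, h2] at h1
    simpa using h1

/-- Character rigidity passes between an ICC group and its normal subgroups of finite index. -/
theorem isCharacterRigid_iff_of_normal (hG : IsICC G) (N : Subgroup G) [N.Normal]
    [N.FiniteIndex] : IsCharacterRigid G ↔ IsCharacterRigid N := by
  have hN := hG.subgroup N
  let _ : Fintype (G ⧸ N) := N.fintypeQuotientOfFiniteIndex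
  rw [hG.isCharacterRigid_iff, hN.isCharacterRigid_iff]
  constructor
  · intro hrig φ hφ
    obtain ⟨χ, hχ, hχφ⟩ := exists_mem_groupCharacters_map_eq (restrictTo N)
      (continuous_restrictTo N) (fun _ => restrictTo_mem_invariantTraces)
      (conjAverage_mem_extremePoints hφ)
      ⟨_, zeroExtension_mem_groupTraces (conjAverage_mem_invariantTraces hφ.1),
        restrictTo_zeroExtension _⟩
    have hle := card_smul_conjAverage_sub hφ.1
    rcases hrig χ hχ with h | h
    · left
      have h1 : HasFiniteRank (conjAverage N φ) := hχφ ▸ h.hasFiniteRank.comp N.subtype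
      exact isFinDimCharacter_of_hasFiniteRank hφ (h1.mono hφ.1.1 hle)
    · right
      refine hN.eq_zero_of_le hφ.1 (conjAverage_mem_invariantTraces hφ.1).1 hle fun n hn => ?_
      rw [← hχφ, restrictTo_apply]
      exact h n (by simpa using hn)
  · intro hrig φ hφ
    have hinv := restrictTo_mem_invariantTraces (N := N) hφ.1
    obtain ⟨α, hα, hαφ⟩ := exists_mem_groupCharacters_map_eq (conjAverage N)
      continuous_conjAverage (fun _ => conjAverage_mem_invariantTraces)
      (restrictTo_mem_extremePoints hφ) ⟨_, hinv.1, conjAverage_eq_self hinv.2⟩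
    rcases hrig α hα with h | h
    · left
      refine isFinDimCharacter_of_hasFiniteRank hφ (HasFiniteRank.of_restrictTo hφ.1.1 (N := N) ?_)
      exact hαφ ▸ h.hasFiniteRank.conjAverage
    · right
      refine hG.eq_zero_of_restrictTo N hφ.1 fun n hn => ?_
      rw [← hαφ, conjAverage_apply, Finset.sum_apply]
      refine Finset.sum_eq_zero fun q _ => ?_
      rw [Pi.smul_apply, conjBy_apply, h _ (by simpa using hn), smul_zero]

lemma comp_mem_groupTraces {K : Type*} [Group K] {φ : K → ℂ} (hφ : φ ∈ groupTraces K)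
    (e : G →* K) : φ ∘ e ∈ groupTraces G :=
  ⟨hφ.1.comp e, by simp [hφ.2.1], fun g h => by simpa using hφ.2.2 (e g) (e h)⟩

/-- Finite rank serves to transport finite-dimensional characters along an isomorphism. -/
lemma isCharacterRigid_of_mulEquiv {K : Type*} [Group K] (hG : IsICC G) (hK : IsICC K)
    (e : G ≃* K) (hrig : IsCharacterRigid G) : IsCharacterRigid K := by
  rw [hK.isCharacterRigid_iff]
  rw [hG.isCharacterRigid_iff] at hrig
  intro φ hφ
  have hφe : φ ∘ e ∈ groupCharacters G := by
    refine ⟨comp_mem_groupTraces hφ.1 e.toMonoidHom, fun α hα β hβ h => ?_⟩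
    obtain ⟨a, b, ha, hb, hab, hsum⟩ := h
    have h1 := hφ.2 (comp_mem_groupTraces hα e.symm.toMonoidHom)
      (comp_mem_groupTraces hβ e.symm.toMonoidHom) ⟨a, b, ha, hb, hab, by
        ext k
        simpa using congrFun hsum (e.symm k)⟩
    ext g
    simpa using congrFun h1 (e g)
  rcases hrig _ hφe with h | h
  · left
    refine isFinDimCharacter_of_hasFiniteRank hφ ?_
    have h1 := h.hasFiniteRank.comp e.symm.toMonoidHom
    convert h1 using 1
    ext k
    simp
  · right
    intro k hk
    simpa using h (e.symm k) (by simpa using hk)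

end

theorem mainTheorem8 {Λ : Type*} [Group Λ] [Countable Λ] (hICC : IsICC Λ)
    (hrep : HasCountablyManyFinDimUnitaryReps Λ) (Λ₀ : Subgroup Λ) [Λ₀.FiniteIndex] :
    IsCharacterRigid Λ ↔ IsCharacterRigid Λ₀ := by
  let N := Λ₀.normalCore
  let N' := N.subgroupOf Λ₀
  have h₀ := hICC.subgroup Λ₀
  have hN := hICC.subgroup N
  have hN' := h₀.subgroup N'
  let e : N' ≃* N := Subgroup.subgroupOfEquivOfLe Λ₀.normalCore_le
  rw [isCharacterRigid_iff_of_normal hICC N, isCharacterRigid_iff_of_normal h₀ N']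
  exact ⟨isCharacterRigid_of_mulEquiv hN hN' e.symm, isCharacterRigid_of_mulEquiv hN' hN e⟩
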